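/- Fix a set $X$ of variables. A (finite) read/write-memory history is $h=(O,\mathsf{PO},\ell)$, where $O$ is a set of $n$ operations, the program order $\mathsf{PO}$ is a strict partial order on $O$ that is a disjoint union of total orders (one per site), and $\ell$ labels each operation as a write $\mathrm{wr}(x,v)$ (return value $\bot$) or a read $\mathrm{rd}(x)\triangleright v$, with $x\in X$, $v\in\mathbb N$. The history is *differentiated* if no two distinct operations write the same value to the same variable and no operation writes the initial value $0$. The specification $S_{\mathsf{RW}}$ is the set of finite sequences of such labels in which every read of $x$ returns the value of the last preceding write to $x$, or $0$ if there is none. For a relation $R$ on $O$ write $R^{\le}(o)=\{o' : o'\mathrel{R}o \text{ or } o'=o\}$. For $A,K\subseteq O$ and an order $R$, say that $(A,R)$ *is explained with the return values of $K$* if the operations of $A$ can be arranged in a sequence (each exactly once) that respects $R$ on $A$, in such a way that replacing the return values of the operations outside $K$ by suitable values yields a sequence of $S_{\mathsf{RW}}$. The history $h$ is * CC (causally consistent) if there is a strict partial order $\mathit{co}\supseteq\mathsf{PO}$ on $O$ such that for every $o\in O$, $(\mathit{co}^{\le}(o),\mathit{co})$ is explained with the return value of $o$; * CM (causal memory) if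 there is a strict partial order $\mathit{co}\supseteq\mathsf{PO}$ such that for every $o\in O$, $(\mathit{co}^{\le}(o),\mathit{co})$ is explained with the return values of $\mathsf{PO}^{\le}(o)$; * CCv (causally convergent) if there are a strict partial order $\mathit{co}\supseteq\mathsf{PO}$ and a strict total order $\mathit{arb}\supseteq\mathit{co}$ on $O$ such that for every $o\in O$, $(\mathit{co}^{\le}(o),\mathit{arb})$ is explained with the return value of $o$. **Theorem.** For each of the three criteria CC, CM and CCv there is an algorithm that, given a differentiated read/write-memory history $h$ with $n$ operations, decides in time $O(n^5)$ whether $h$ satisfies the criterion. Here an algorithm is one fixed random access program over registers and arrays of natural numbers, with addition, truncated subtraction, comparisons and indexed access at unit cost. The input consists of $n$, the kind, the variable (named by a natural number, distinct variables having distinct names) and the value of each operation, and the $n\times n$ zero-one matrix of $\mathsf{PO}$; the bound depends on $n$ only, not on the size of the names and values. -/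

import Mathlib

/-! ### Histories, sequences of a specification, and the three consistency criteria -/

universe u v w

/-- The label `(m, arg, rv)` of an operation: method, input, return value. -/
abbrev OpLabel (M : Type u) (D : Type v) : Type (max u v) := M × D × D

/-- A label whose return value may have been hidden (`none`). -/
abbrev PartialLabel (M : Type u) (D : Type v) : Type (max u v) := M × D × Option D

/-- A history `(O, PO, ℓ)`. The program order is a union of total orders, one for each site:
it is a strict partial order for which "equal or comparable" (that is, "submitted to the same
site") is an equivalence relation. -/
structure History (O : Type u) (M : Type v) (D : Type w) where
  po : O → O → Prop
  po_strict : IsStrictOrder O po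
  po_sites : Equivalence fun a b => a = b ∨ po a b ∨ po b a
  label : O → OpLabel M D

/-- A specification: a set of sequences of labels. -/
abbrev Specification (M : Type u) (D : Type v) : Type (max u v) := Set (List (OpLabel M D))

/-- The elements equal to `o` or `R`-below `o`. For a causal order this is the causal past of `o`,
for the program order it is the set of operations of the site of `o` up to and including `o`. -/
def pastOf {O : Type u} (R : O → O → Prop) (o : O) : Set O := {o' | R o' o ∨ o' = o}

open Classical in
/-- The labelling of `h` in which only the return values of the operations in `K` are kept. -/
noncomputable def History.keepRv {O : Type u} {M : Type v} {D : Type w} (h : History O M D)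
    (K : Set O) (o : O) : PartialLabel M D :=
  ((h.label o).1, (h.label o).2.1, if o ∈ K then some (h.label o).2.2 else none)

/-- The full label `l` refines the partial label `p`: it has the same method and input, and the
same return value unless that of `p` is hidden. -/
def LabelRefines {M : Type u} {D : Type v} (p : PartialLabel M D) (l : OpLabel M D) : Prop :=
  p.1 = l.1 ∧ p.2.1 = l.2.1 ∧ ∀ rv, p.2.2 = some rv → rv = l.2.2

/-- `(A, R, ℓ) ≼ ρ`: the labelled sequence `ρ`, a list of operations with their labels, is a
sequence of exactly the operations in `A`, its order contains the restriction of `R` to `A`, and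
its labels refine those given by `ℓ`. -/
def SequencedBy {O : Type u} {M : Type v} {D : Type w} (A : Set O) (R : O → O → Prop)
    (ℓ : O → PartialLabel M D) (ρ : List (O × OpLabel M D)) : Prop :=
  (ρ.map Prod.fst).Nodup ∧
  (∀ a, a ∈ ρ.map Prod.fst ↔ a ∈ A) ∧
  (∀ a ∈ A, ∀ b ∈ A, R a b → List.Sublist [a, b] (ρ.map Prod.fst)) ∧
  ∀ p ∈ ρ, LabelRefines (ℓ p.1) p.2

/-- Causal consistency. -/
def History.IsCC {O : Type u} {M : Type v} {D : Type w} (h : History O M D)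
    (S : Specification M D) : Prop :=
  ∃ co : O → O → Prop, IsStrictOrder O co ∧ (∀ a b, h.po a b → co a b) ∧
    ∀ o, ∃ ρ : List (O × OpLabel M D), ρ.map Prod.snd ∈ S ∧
      SequencedBy (pastOf co o) co (h.keepRv {o}) ρ

/-- Causal memory. -/
def History.IsCM {O : Type u} {M : Type v} {D : Type w} (h : History O M D)
    (S : Specification M D) : Prop :=
  ∃ co : O → O → Prop, IsStrictOrder O co ∧ (∀ a b, h.po a b → co a b) ∧
    ∀ o, ∃ ρ : List (O × OpLabel M D), ρ.map Prod.snd ∈ S ∧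
      SequencedBy (pastOf co o) co (h.keepRv (pastOf h.po o)) ρ

/-- Causal convergence. -/
def History.IsCCv {O : Type u} {M : Type v} {D : Type w} (h : History O M D)
    (S : Specification M D) : Prop :=
  ∃ co arb : O → O → Prop, IsStrictOrder O co ∧ IsStrictTotalOrder O arb ∧
    (∀ a b, h.po a b → co a b) ∧ (∀ a b, co a b → arb a b) ∧
    ∀ o, ∃ ρ : List (O × OpLabel M D), ρ.map Prod.snd ∈ S ∧
      SequencedBy (pastOf co o) arb (h.keepRv {o}) ρ

/-- The three consistency criteria. -/
inductive Criterion where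
  | CC
  | CM
  | CCv

/-- `c.Holds h S`: the history `h` satisfies `c` with respect to the specification `S`. -/
def Criterion.Holds {O : Type u} {M : Type v} {D : Type w} (c : Criterion)
    (h : History O M D) (S : Specification M D) : Prop :=
  match c with
  | .CC => h.IsCC S
  | .CM => h.IsCM S
  | .CCv => h.IsCCv S

/-! ### The read/write memory -/

inductive RWMethod where
  | wr
  | rd

/-- The domain `(X × ℕ) ⊎ X ⊎ ℕ ⊎ {⊥}` of the read/write memory with variables `X`. -/
inductive RWData (X : Type u) where
  | pair (x : X) (v : ℕ)
  | var (x : X)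
  | val (v : ℕ)
  | bot

abbrev RWLabel (X : Type u) : Type u := OpLabel RWMethod (RWData X)

/-- The label of a write of the value `v` to the variable `x`. -/
def wrLabel {X : Type u} (x : X) (v : ℕ) : RWLabel X := (.wr, .pair x v, .bot)

/-- The label of a read of the variable `x` that returns the value `v`. -/
def rdLabel {X : Type u} (x : X) (v : ℕ) : RWLabel X := (.rd, .var x, .val v)

/-- The sequences of the read/write memory; variables are initially `0`. -/
inductive RWSpec {X : Type u} : List (RWLabel X) → Prop where
  | nil : RWSpec []
  | write (ρ : List (RWLabel X)) (x : X) (v : ℕ) : RWSpec ρ → RWSpec (ρ ++ [wrLabel x v])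
  | readInit (ρ : List (RWLabel X)) (x : X) : RWSpec ρ → (∀ u, wrLabel x u ∉ ρ) →
      RWSpec (ρ ++ [rdLabel x 0])
  | read (ρ ρ₁ ρ₂ : List (RWLabel X)) (x : X) (v : ℕ) : RWSpec ρ →
      ρ = ρ₁ ++ wrLabel x v :: ρ₂ → (∀ u, wrLabel x u ∉ ρ₂) → RWSpec (ρ ++ [rdLabel x v])

/-- The specification of the read/write memory. -/
def rwMemory (X : Type u) : Specification RWMethod (RWData X) := {ρ | RWSpec ρ}

/-- A read/write memory history: every operation is a write or a read of a variable. -/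
def History.IsRW {O : Type u} {X : Type v} (h : History O RWMethod (RWData X)) : Prop :=
  ∀ o, ∃ x v, h.label o = wrLabel x v ∨ h.label o = rdLabel x v

/-- The variables that occur in a read/write memory history. -/
def History.vars {O : Type u} {X : Type v} (h : History O RWMethod (RWData X)) : Set X :=
  {x | ∃ o v, h.label o = wrLabel x v ∨ h.label o = rdLabel x v}

/-- Differentiated: no two operations write the same value to the same variable, and no operation
writes the initial value `0`. -/
def History.Differentiated {O : Type u} {X : Type v} (h : History O RWMethod (RWData X)) : Prop :=
  (∀ o₁ o₂ x d₁ d₂, o₁ ≠ o₂ → h.label o₁ = wrLabel x d₁ → h.label o₂ = wrLabel x d₂ → d₁ ≠ d₂) ∧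
  ∀ o x, h.label o ≠ wrLabel x 0

/-! ### Random access programs with a step count

Programs act on registers and finitely many named arrays of natural numbers. The only arithmetic
is addition and truncated subtraction, with comparisons; there is no multiplication. Every node of
an evaluated expression, every assignment and every test costs one step. -/

/-- The memory: registers, and named arrays. -/
structure MemState where
  reg : ℕ → ℕ
  arr : ℕ → ℕ → ℕ

/-- Expressions; `get a e` is the entry of array `a` at the index `e`. -/
inductive RamExpr where
  | const (k : ℕ)
  | reg (r : ℕ)
  | get (a : ℕ) (e : RamExpr)
  | add (e f : RamExpr)
  | sub (e f : RamExpr)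
  | eq (e f : RamExpr)
  | lt (e f : RamExpr)

/-- The value of an expression; the comparisons have the value `1` (true) or `0` (false). -/
def RamExpr.eval (s : MemState) : RamExpr → ℕ
  | .const k => k
  | .reg r => s.reg r
  | .get a e => s.arr a (e.eval s)
  | .add e f => e.eval s + f.eval s
  | .sub e f => e.eval s - f.eval s
  | .eq e f => if e.eval s = f.eval s then 1 else 0
  | .lt e f => if e.eval s < f.eval s then 1 else 0

/-- The number of steps it takes to evaluate an expression. -/
def RamExpr.cost : RamExpr → ℕ
  | .const _ => 1
  | .reg _ => 1
  | .get _ e => e.cost + 1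
  | .add e f => e.cost + f.cost + 1
  | .sub e f => e.cost + f.cost + 1
  | .eq e f => e.cost + f.cost + 1
  | .lt e f => e.cost + f.cost + 1

/-- Programs: `assign r e` sets register `r` to `e`, and `store a i e` sets the entry of array `a`
at the index `i` to `e`. A test succeeds when its value is not `0`. -/
inductive RamProg where
  | skip
  | assign (r : ℕ) (e : RamExpr)
  | store (a : ℕ) (i e : RamExpr)
  | seq (p q : RamProg)
  | ite (e : RamExpr) (p q : RamProg)
  | loop (e : RamExpr) (p : RamProg)

/-- `RamProg.Run p s s' t`: the program `p` started in `s` halts in `s'` after exactly `t` steps. -/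
inductive RamProg.Run : RamProg → MemState → MemState → ℕ → Prop where
  | skip (s : MemState) : Run .skip s s 1
  | assign (r : ℕ) (e : RamExpr) (s : MemState) :
      Run (.assign r e) s { s with reg := Function.update s.reg r (e.eval s) } (e.cost + 1)
  | store (a : ℕ) (i e : RamExpr) (s : MemState) :
      Run (.store a i e) s
        { s with arr := Function.update s.arr a (Function.update (s.arr a) (i.eval s) (e.eval s)) }
        (i.cost + e.cost + 1)
  | seq (p q : RamProg) (s s' s'' : MemState) (t t' : ℕ) :
      Run p s s' t → Run q s' s'' t' → Run (.seq p q) s s'' (t + t')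
  | ite_true (e : RamExpr) (p q : RamProg) (s s' : MemState) (t : ℕ) :
      e.eval s ≠ 0 → Run p s s' t → Run (.ite e p q) s s' (e.cost + 1 + t)
  | ite_false (e : RamExpr) (p q : RamProg) (s s' : MemState) (t : ℕ) :
      e.eval s = 0 → Run q s s' t → Run (.ite e p q) s s' (e.cost + 1 + t)
  | loop_true (e : RamExpr) (p : RamProg) (s s' s'' : MemState) (t t' : ℕ) :
      e.eval s ≠ 0 → Run p s s' t → Run (.loop e p) s' s'' t' →
      Run (.loop e p) s s'' (e.cost + 1 + t + t')
  | loop_false (e : RamExpr) (p : RamProg) (s : MemState) :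
      e.eval s = 0 → Run (.loop e p) s s (e.cost + 1)

/-! ### The representation of a history in memory -/

/-- `0` for a write, `1` for a read. -/
def methodCode {X : Type u} : RWLabel X → ℕ
  | (.wr, _, _) => 0
  | (.rd, _, _) => 1

/-- The variable of an operation, as a number; `0` if the label is not that of a write or read. -/
def varCode {X : Type u} (name : X → ℕ) : RWLabel X → ℕ
  | (.wr, .pair x _, _) => name x
  | (.rd, .var x, _) => name x
  | _ => 0

/-- The value of an operation; `0` if the label is not that of a write or read. -/
def valueCode {X : Type u} : RWLabel X → ℕ
  | (.wr, .pair _ v, _) => v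
  | (.rd, _, .val v) => v
  | _ => 0

open Classical in
/-- The initial memory on the input `h`, a history with operations `0, …, n - 1`. Register `0` holds
`n`; entry `i < n` of the arrays `0`, `1`, `2` holds the method, the variable and the value of
operation `i`; array `3` holds the program order as an `n × n` matrix of zeros and ones, row by row.
Everything else is `0`. -/
noncomputable def inputMemory {X : Type u} (name : X → ℕ) {n : ℕ}
    (h : History (Fin n) RWMethod (RWData X)) : MemState where
  reg r := if r = 0 then n else 0
  arr a k :=
    match a with
    | 0 => if hk : k < n then methodCode (h.label ⟨k, hk⟩) else 0
    | 1 => if hk : k < n then varCode name (h.label ⟨k, hk⟩) else 0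
    | 2 => if hk : k < n then valueCode (h.label ⟨k, hk⟩) else 0
    | 3 => if ∃ i j : Fin n, k = i.val * n + j.val ∧ h.po i j then 1 else 0
    | _ => 0

/-!
A read is explained by a total order exactly if its source precedes it and every other write of the
same variable that precedes the read also precedes the source. Since the values written are
distinct, the source is determined by the history, so every criterion becomes the acyclicity of an
order that is forced. It contains the causal order, generated by the program order and reads-from,
and a read `r` adds the edge from `w` to the source of `r` whenever `w` is already before `r`.

For CC and CM, one such happens-before order is computed for each operation `o`, from the reads
whose values are kept for `o`. These form a chain of the program order, hence a total order exists
that places before each of them only what happens before it, and this order explains `o`.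
For the same reason `n` rounds of saturation suffice: below a read of the chain, only the edges
forced by later reads of the chain matter. With Warshall's algorithm a round takes time `O(n ^ 3)`,
so `n` rounds for each of `n` operations take time `O(n ^ 5)`.

For CCv, the edges forced by the causal order alone must be contained in the arbitration order, and
any total order that contains them is an arbitration order, so a single round suffices.

The computations only redefine relations by quantifier-free formulas inside loops over the
operations. In a small language with just these constructs, the degree of the running time is read
off from the nesting of the loops.
-/

/-! ### Sequences of the read/write memory -/

section Sequences

variable {X : Type u} {ρ σ : List (RWLabel X)} {p : RWLabel X} {x y : X} {v w : ℕ}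

/-- After the sequence `ρ`, a read of `x` returns `v`. -/
def RWReturns (ρ : List (RWLabel X)) (x : X) (v : ℕ) : Prop :=
  (v = 0 ∧ ∀ u, wrLabel x u ∉ ρ) ∨
    ∃ ρ₁ ρ₂, ρ = ρ₁ ++ wrLabel x v :: ρ₂ ∧ ∀ u, wrLabel x u ∉ ρ₂

theorem rdLabel_inj : rdLabel x v = rdLabel y w ↔ x = y ∧ v = w := by
  simp [rdLabel]

theorem wrLabel_ne_rdLabel : wrLabel x v ≠ rdLabel y w := by
  simp [wrLabel, rdLabel]

theorem rwReturns_concat_iff : RWReturns (ρ ++ [p]) x v ↔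
    p = wrLabel x v ∨ (∀ u, wrLabel x u ≠ p) ∧ RWReturns ρ x v := by
  constructor
  · rintro (⟨rfl, hno⟩ | ⟨ρ₁, ρ₂, e, hno⟩)
    · simp only [List.mem_append, List.mem_singleton, not_or] at hno
      exact .inr ⟨fun u => (hno u).2, .inl ⟨rfl, fun u => (hno u).1⟩⟩
    · rcases ρ₂.eq_nil_or_concat' with rfl | ⟨ρ₂, q, rfl⟩
      · exact .inl (by simpa using (List.append_inj' e rfl).2)
      · rw [← List.cons_append, ← List.append_assoc] at e
        obtain ⟨rfl, e⟩ := List.append_inj' e rfl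
        obtain rfl : p = q := by simpa using e
        simp only [List.mem_append, List.mem_singleton, not_or] at hno
        exact .inr ⟨fun u => (hno u).2, .inr ⟨ρ₁, ρ₂, rfl, fun u => (hno u).1⟩⟩
  · rintro (rfl | ⟨hp, ⟨rfl, hno⟩ | ⟨ρ₁, ρ₂, rfl, hno⟩⟩)
    · exact .inr ⟨ρ, [], rfl, by simp⟩
    · exact .inl ⟨rfl, fun u => by simp [hno u, hp u]⟩
    · exact .inr ⟨ρ₁, ρ₂ ++ [p], by simp, fun u => by simp [hno u, hp u]⟩

theorem exists_rwReturns (ρ : List (RWLabel X)) (x : X) : ∃ v, RWReturns ρ x v := by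
  induction ρ using List.reverseRecOn with
  | nil => exact ⟨0, .inl ⟨rfl, by simp⟩⟩
  | append_singleton ρ p ih =>
    by_cases hp : ∃ v, p = wrLabel x v
    · exact hp.imp fun v hv => rwReturns_concat_iff.2 (.inl hv)
    · exact ih.imp fun v hv => rwReturns_concat_iff.2 (.inr ⟨fun u hu => hp ⟨u, hu.symm⟩, hv⟩)

theorem rwReturns_map_congr {α : Type*} {f g : α → RWLabel X} {l : List α}
    (hfg : ∀ a ∈ l, ∀ u, f a = wrLabel x u ↔ g a = wrLabel x u) :
    RWReturns (l.map f) x v ↔ RWReturns (l.map g) x v := by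
  induction l using List.reverseRecOn with
  | nil => rfl
  | append_singleton l a ih =>
    have ha := hfg a (by simp)
    simp only [List.map_append, List.map_cons, List.map_nil, rwReturns_concat_iff, ha, ne_eq,
      eq_comm (a := wrLabel x _), ih fun b hb => hfg b (List.mem_append_left _ hb)]

theorem rwSpec_concat_iff : RWSpec (ρ ++ [p]) ↔
    RWSpec ρ ∧ ∃ x v, p = wrLabel x v ∨ (p = rdLabel x v ∧ RWReturns ρ x v) := by
  constructor
  · intro h
    generalize e : ρ ++ [p] = σ at h
    cases h with
    | nil => simp at e
    | write τ x v h =>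
      obtain ⟨rfl, hp⟩ := List.append_inj' e rfl
      exact ⟨h, x, v, .inl (by simpa using hp)⟩
    | readInit τ x h hno =>
      obtain ⟨rfl, hp⟩ := List.append_inj' e rfl
      exact ⟨h, x, 0, .inr ⟨by simpa using hp, .inl ⟨rfl, hno⟩⟩⟩
    | read τ τ₁ τ₂ x v h eτ hno =>
      obtain ⟨rfl, hp⟩ := List.append_inj' e rfl
      exact ⟨h, x, v, .inr ⟨by simpa using hp, .inr ⟨τ₁, τ₂, eτ, hno⟩⟩⟩
  · rintro ⟨h, x, v, rfl | ⟨rfl, ⟨rfl, hno⟩ | ⟨ρ₁, ρ₂, e, hno⟩⟩⟩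
    · exact .write ρ x v h
    · exact .readInit ρ x h hno
    · exact .read ρ ρ₁ ρ₂ x v h e hno

theorem RWSpec.of_append (h : RWSpec (ρ ++ σ)) : RWSpec ρ := by
  induction σ using List.reverseRecOn with
  | nil => simpa using h
  | append_singleton σ p ih => exact ih (rwSpec_concat_iff.1 (by simpa using h)).1

theorem RWSpec.eq_wrLabel_or_eq_rdLabel (h : RWSpec ρ) (hp : p ∈ ρ) :
    ∃ x v, p = wrLabel x v ∨ p = rdLabel x v := by
  obtain ⟨ρ₁, ρ₂, rfl⟩ := List.append_of_mem hp
  obtain ⟨-, x, v, hp | ⟨hp, -⟩⟩ :=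
    rwSpec_concat_iff.1 (RWSpec.of_append (ρ := ρ₁ ++ [p]) (σ := ρ₂) (by simpa using h))
  · exact ⟨x, v, .inl hp⟩
  · exact ⟨x, v, .inr hp⟩

end Sequences

/-! ### Explanations -/

section Explanations

variable {O : Type u} {X : Type v} {h : History O RWMethod (RWData X)} {A K : Set O}
  {R lt : O → O → Prop}

/-- `(A, R)` is explained with the return values of `K`. -/
def History.IsExplained (h : History O RWMethod (RWData X)) (A K : Set O) (R : O → O → Prop) :
    Prop :=
  ∃ ρ : List (O × RWLabel X), ρ.map Prod.snd ∈ rwMemory X ∧ SequencedBy A R (h.keepRv K) ρ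

/-- In the sequence `l` of operations, every read in `K` returns what the preceding writes make it
return. Return values outside `K` can be chosen freely, so these are the only constraints. -/
def History.Replays (h : History O RWMethod (RWData X)) (K : Set O) (l : List O) : Prop :=
  ∀ l₁ r, l₁ ++ [r] <+: l → r ∈ K → ∀ x v, h.label r = rdLabel x v →
    RWReturns (l₁.map h.label) x v

theorem LabelRefines.eq_label {o : O} {p : RWLabel X} (hp : LabelRefines (h.keepRv K o) p)
    (ho : o ∈ K) : p = h.label o :=
  Prod.ext hp.1.symm (Prod.ext hp.2.1.symm (hp.2.2 _ (by simp [History.keepRv, ho])).symm)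

theorem LabelRefines.label_eq_wrLabel_iff (hrw : h.IsRW) {o : O} {p : RWLabel X}
    (hp : LabelRefines (h.keepRv K o) p) (hp' : ∃ x v, p = wrLabel x v ∨ p = rdLabel x v)
    {x : X} {v : ℕ} : p = wrLabel x v ↔ h.label o = wrLabel x v := by
  obtain ⟨hmethod, harg, -⟩ := hp
  obtain ⟨y, w, ho⟩ := hrw o
  obtain ⟨z, u, hp⟩ := hp'
  simp only [History.keepRv] at hmethod harg
  rcases ho with ho | ho <;> rcases hp with hp | hp <;> rw [ho, hp] at hmethod harg ⊢ <;>
    simp_all [wrLabel, rdLabel]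

theorem rwReturns_map_snd_iff (hrw : h.IsRW) {ρ : List (O × RWLabel X)}
    (hρ : RWSpec (ρ.map Prod.snd)) (href : ∀ p ∈ ρ, LabelRefines (h.keepRv K p.1) p.2)
    {x : X} {v : ℕ} :
    RWReturns (ρ.map Prod.snd) x v ↔ RWReturns ((ρ.map Prod.fst).map h.label) x v := by
  rw [List.map_map]
  exact rwReturns_map_congr fun p hp u => (href p hp).label_eq_wrLabel_iff hrw
    (hρ.eq_wrLabel_or_eq_rdLabel (List.mem_map_of_mem hp))

theorem replays_map_fst (hrw : h.IsRW) {ρ : List (O × RWLabel X)} (hρ : RWSpec (ρ.map Prod.snd))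
    (href : ∀ p ∈ ρ, LabelRefines (h.keepRv K p.1) p.2) : h.Replays K (ρ.map Prod.fst) := by
  rintro l₁ r ⟨l₂, e⟩ hr x v hx
  rw [List.append_assoc] at e
  obtain ⟨ρ₁, ρ', rfl, rfl, e'⟩ := List.map_eq_append_iff.1 e.symm
  obtain ⟨p, ρ₂, rfl, rfl, -⟩ := List.map_eq_cons_iff.1 e'
  have hspec : RWSpec (ρ₁.map Prod.snd ++ [p.2]) :=
    RWSpec.of_append (σ := ρ₂.map Prod.snd) (by simpa using hρ)
  have hp : p.2 = rdLabel x v := ((href p (by simp)).eq_label hr).trans hx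
  obtain ⟨hspec₁, y, w, hy | ⟨hy, hret⟩⟩ := rwSpec_concat_iff.1 hspec
  · exact (wrLabel_ne_rdLabel (hy.symm.trans hp)).elim
  · obtain ⟨rfl, rfl⟩ := rdLabel_inj.1 (hy.symm.trans hp)
    exact (rwReturns_map_snd_iff hrw hspec₁
      fun q hq => href q (List.mem_append_left _ hq)).1 hret

theorem History.Replays.exists_map_fst_eq (hrw : h.IsRW) {l : List O} (hl : h.Replays K l) :
    ∃ ρ : List (O × RWLabel X), ρ.map Prod.fst = l ∧ RWSpec (ρ.map Prod.snd) ∧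
      ∀ p ∈ ρ, LabelRefines (h.keepRv K p.1) p.2 := by
  induction l using List.reverseRecOn with
  | nil => exact ⟨[], rfl, .nil, by simp⟩
  | append_singleton l r ih =>
    obtain ⟨ρ, rfl, hρ, href⟩ :=
      ih fun l₁ r' hpre => hl l₁ r' (hpre.trans (List.prefix_append _ _))
    suffices ∃ p, RWSpec (ρ.map Prod.snd ++ [p]) ∧ LabelRefines (h.keepRv K r) p by
      obtain ⟨p, hspec, hp⟩ := this
      exact ⟨ρ ++ [(r, p)], by simp, by simpa using hspec,
        List.forall_mem_append.2 ⟨href, by simpa using hp⟩⟩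
    obtain ⟨x, v, hx | hx⟩ := hrw r
    · exact ⟨wrLabel x v, .write _ x v hρ, by simp [LabelRefines, History.keepRv, hx, wrLabel]⟩
    obtain ⟨u, hu, hru⟩ : ∃ u, RWReturns (ρ.map Prod.snd) x u ∧ (r ∈ K → u = v) := by
      by_cases hr : r ∈ K
      · exact ⟨v, (rwReturns_map_snd_iff hrw hρ href).2 (hl _ r List.prefix_rfl hr x v hx),
          fun _ => rfl⟩
      · exact (exists_rwReturns _ x).imp fun u hu => ⟨hu, fun hr' => (hr hr').elim⟩
    refine ⟨rdLabel x u, rwSpec_concat_iff.2 ⟨hρ, x, u, .inr ⟨rfl, hu⟩⟩, ?_⟩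
    simpa [LabelRefines, History.keepRv, hx, rdLabel, eq_comm] using hru

theorem isExplained_iff_exists_replays (hrw : h.IsRW) : h.IsExplained A K R ↔
    ∃ l : List O, l.Nodup ∧ (∀ a, a ∈ l ↔ a ∈ A) ∧
      (∀ a ∈ A, ∀ b ∈ A, R a b → List.Sublist [a, b] l) ∧ h.Replays K l := by
  constructor
  · rintro ⟨ρ, hρ, hnodup, hmem, hsub, href⟩
    exact ⟨_, hnodup, hmem, hsub, replays_map_fst hrw hρ href⟩
  · rintro ⟨l, hnodup, hmem, hsub, hl⟩
    obtain ⟨ρ, rfl, hρ, href⟩ := hl.exists_map_fst_eq hrw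
    exact ⟨ρ, hρ, hnodup, hmem, hsub, href⟩

end Explanations

/-! ### Total orders -/

section TotalOrders

variable {α : Type*}

theorem exists_strictTotalOrder_refining {β : Type*} [LinearOrder β] (R : α → α → Prop)
    [IsStrictOrder α R] (f : α → β) (hf : ∀ a b, R a b → f a ≤ f b) :
    ∃ lt : α → α → Prop, IsStrictTotalOrder α lt ∧ (∀ a b, R a b → lt a b) ∧
      ∀ a b, f a < f b → lt a b := by
  let := partialOrderOfSO R
  have hinj : Function.Injective (toLinearExtension : α → LinearExtension α) := fun _ _ => id
  let g : α ↪ β ×ₗ LinearExtension α :=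
    ⟨fun a => toLex (f a, toLinearExtension a), fun _ _ hab => hinj (congrArg Prod.snd hab)⟩
  refine ⟨Order.Preimage g (· < ·),
    (RelEmbedding.preimage g (· < ·)).isStrictTotalOrder, fun a b hab => ?_,
    fun a b hab => Prod.Lex.toLex_lt_toLex.2 (.inl hab)⟩
  have hext : toLinearExtension a < toLinearExtension b :=
    toLinearExtension.monotone.strictMono_of_injective hinj hab
  exact Prod.Lex.toLex_lt_toLex.2 ((hf a b hab).lt_or_eq.imp id fun hfab => ⟨hfab, hext⟩)

theorem exists_strictTotalOrder_pairwise {l : List α} (hl : l.Nodup) :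
    ∃ lt : α → α → Prop, IsStrictTotalOrder α lt ∧ l.Pairwise lt := by
  classical
  have : IsStrictOrder α fun _ _ => False := { irrefl := fun _ => id, trans := fun _ _ _ h _ => h }
  obtain ⟨lt, hlt, -, hidx⟩ := exists_strictTotalOrder_refining (fun _ _ : α => False) l.idxOf
    fun _ _ => False.elim
  refine ⟨lt, hlt, List.pairwise_iff_getElem.2 fun i j hi hj hij => hidx _ _ ?_⟩
  rwa [hl.idxOf_getElem, hl.idxOf_getElem]

theorem exists_strictTotalOrder_of_isChain [Finite α] (R : α → α → Prop) [IsStrictOrder α R]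
    {K : Set α} (hK : IsChain R K) :
    ∃ lt : α → α → Prop, IsStrictTotalOrder α lt ∧ (∀ a b, R a b → lt a b) ∧
      ∀ r ∈ K, ∀ a, lt a r → R a r := by
  -- An element is placed after exactly those elements of the chain that it does not precede in `R`.
  let f : α → ℕ := fun a => {r ∈ K | a ∉ pastOf R r}.ncard
  have hpast : ∀ {a b r}, R a b → b ∈ pastOf R r → a ∈ pastOf R r := by
    rintro a b r hab (hbr | rfl)
    exacts [.inl (trans_of R hab hbr), .inl hab]
  have hf : ∀ a b, R a b → f a ≤ f b := fun a b hab =>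
    Set.ncard_le_ncard (fun r hr => ⟨hr.1, fun hb => hr.2 (hpast hab hb)⟩) (Set.toFinite _)
  obtain ⟨lt, hlt, hR, hflt⟩ := exists_strictTotalOrder_refining R f hf
  refine ⟨lt, hlt, hR, fun r hr a har => ?_⟩
  by_contra hnot
  have hpast_r : a ∉ pastOf R r := by
    rintro (h | rfl)
    exacts [hnot h, irrefl_of lt a har]
  refine asymm_of lt har (hflt r a (Set.ncard_lt_ncard ⟨fun r' hr' => ⟨hr'.1, fun ha => ?_⟩,
    fun hsub => (hsub ⟨hr, hpast_r⟩).2 (.inr rfl)⟩ (Set.toFinite _)))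
  have hne : r ≠ r' := fun h => hr'.2 (.inr h)
  have hr'r : R r' r := (hK hr hr'.1 hne).resolve_left fun h => hr'.2 (.inl h)
  rcases ha with ha | rfl
  exacts [hnot (trans_of R ha hr'r), hnot hr'r]

theorem exists_pairwise_forall_mem_iff [Finite α] (A : Set α) (lt : α → α → Prop)
    [IsStrictTotalOrder α lt] : ∃ l : List α, l.Pairwise lt ∧ ∀ a, a ∈ l ↔ a ∈ A := by
  classical
  have := Fintype.ofFinite α
  let := linearOrderOfSTO lt
  exact ⟨A.toFinset.sort, A.toFinset.sortedLT_sort.pairwise, by simp⟩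

variable {lt : α → α → Prop} [IsStrictOrder α lt] {l l₁ l₂ : List α} {a b r : α}

theorem sublist_pair_of_pairwise (hl : l.Pairwise lt) (ha : a ∈ l) (hb : b ∈ l) (hab : lt a b) :
    List.Sublist [a, b] l := by
  have : Std.Antisymm lt := ⟨fun x y hxy hyx => (asymm_of lt hxy hyx).elim⟩
  refine List.sublist_of_subperm_of_pairwise (r := lt) ?_ (by simpa using hab) hl
  exact List.subperm_of_subset (by simpa using ne_of_irrefl hab) (by simp [ha, hb])

theorem mem_left_iff_of_pairwise (hl : (l₁ ++ r :: l₂).Pairwise lt) :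
    a ∈ l₁ ↔ a ∈ l₁ ++ r :: l₂ ∧ lt a r := by
  obtain ⟨-, hl₂, hl₁₂⟩ := List.pairwise_append.1 hl
  refine ⟨fun ha => ⟨List.mem_append_left _ ha, hl₁₂ a ha r (by simp)⟩, fun ⟨ha, har⟩ => ?_⟩
  rcases List.mem_append.1 ha with ha | ha
  · exact ha
  · rcases List.mem_cons.1 ha with rfl | ha
    · exact (irrefl_of lt a har).elim
    · exact (asymm_of lt har ((List.pairwise_cons.1 hl₂).1 a ha)).elim

end TotalOrders

/-! ### Orders that explain return values -/

section Respects

variable {O : Type u} {X : Type v} (h : History O RWMethod (RWData X))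

/-- The read `r` returns the value that `w` writes. -/
def History.ReadsFrom (w r : O) : Prop :=
  ∃ x v, h.label w = wrLabel x v ∧ h.label r = rdLabel x v

/-- The read `r` does not return the initial value. -/
def History.NeedsSource (r : O) : Prop := ∃ x v, h.label r = rdLabel x v ∧ v ≠ 0

/-- If the write `w₁` precedes the read `r` of the same variable, then it precedes `w₂`. Here `w₂`
is the source of `r` if there is one; if `r` returns the initial value, then `w₂ = w₁`, so that
`w₁` cannot precede `r`. -/
def History.Conflict (w₁ r w₂ : O) : Prop :=
  ∃ x v, h.label r = rdLabel x v ∧ (∃ u, h.label w₁ = wrLabel x u) ∧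
    ((h.label w₂ = wrLabel x v ∧ w₁ ≠ w₂) ∨ (v = 0 ∧ w₂ = w₁))

/-- In the order `lt` of `A`, the read `r` returns the last preceding value. -/
def History.Respects (lt : O → O → Prop) (A : Set O) (r : O) : Prop :=
  (h.NeedsSource r → ∃ w ∈ A, lt w r ∧ h.ReadsFrom w r) ∧
    ∀ w₁ ∈ A, lt w₁ r → ∀ w₂, h.Conflict w₁ r w₂ → lt w₁ w₂

variable {h} {A K : Set O} {R lt : O → O → Prop}

theorem History.Differentiated.eq_of_label (hd : h.Differentiated) {a b : O} {x : X} {v : ℕ}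
    (ha : h.label a = wrLabel x v) (hb : h.label b = wrLabel x v) : a = b := by
  by_contra hab
  exact hd.1 a b x v v hab ha hb rfl

theorem History.Differentiated.source_unique (hd : h.Differentiated) {w w' r : O}
    (hw : h.ReadsFrom w r) (hw' : h.ReadsFrom w' r) : w = w' := by
  obtain ⟨x, v, hw, hr⟩ := hw
  obtain ⟨y, v', hw', hr'⟩ := hw'
  obtain ⟨rfl, rfl⟩ := rdLabel_inj.1 (hr.symm.trans hr')
  exact hd.eq_of_label hw hw'

theorem History.Differentiated.needsSource (hd : h.Differentiated) {w r : O}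
    (hwr : h.ReadsFrom w r) : h.NeedsSource r := by
  obtain ⟨x, v, hw, hr⟩ := hwr
  exact ⟨x, v, hr, fun hv => hd.2 w x (hv ▸ hw)⟩

theorem History.Conflict.eq_or_readsFrom {w₁ r w₂ : O} (hc : h.Conflict w₁ r w₂) :
    w₁ = w₂ ∨ h.ReadsFrom w₂ r := by
  obtain ⟨x, v, hr, -, ⟨hw, -⟩ | ⟨-, rfl⟩⟩ := hc
  · exact .inr ⟨x, v, hw, hr⟩
  · exact .inl rfl

section Pairwise

variable {l : List O} {r : O} {x : X} {v : ℕ}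

theorem respects_of_rwReturns (hd : h.Differentiated) (hl : l.Pairwise lt)
    (hmem : ∀ a, a ∈ l ↔ a ∈ A ∧ lt a r) (hr : h.label r = rdLabel x v)
    (hret : RWReturns (l.map h.label) x v) : h.Respects lt A r := by
  obtain ⟨rfl, hno⟩ | ⟨ρ₁, ρ₂, e, hno⟩ := hret
  · refine ⟨fun ⟨y, u, hy, hu⟩ => ?_, fun w₁ hw₁ hlt w₂ ⟨y, u, hy, ⟨u', hu'⟩, _⟩ => ?_⟩ <;>
      obtain ⟨rfl, rfl⟩ := rdLabel_inj.1 (hr.symm.trans hy)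
    · exact (hu rfl).elim
    · exact (hno u' (hu' ▸ List.mem_map_of_mem ((hmem w₁).2 ⟨hw₁, hlt⟩))).elim
  obtain ⟨l₁, l', rfl, rfl, e'⟩ := List.map_eq_append_iff.1 e
  obtain ⟨w, l₂, rfl, hw, rfl⟩ := List.map_eq_cons_iff.1 e'
  obtain ⟨hwA, hwr⟩ := (hmem w).1 (by simp)
  refine ⟨fun _ => ⟨w, hwA, hwr, x, v, hw, hr⟩, fun w₁ hw₁ hlt w₂ ⟨y, u, hy, ⟨u', hu'⟩, hw₂⟩ => ?_⟩
  obtain ⟨rfl, rfl⟩ := rdLabel_inj.1 (hr.symm.trans hy)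
  obtain ⟨hw₂, hne⟩ | ⟨rfl, -⟩ := hw₂
  · obtain rfl := hd.eq_of_label hw hw₂
    rcases List.mem_append.1 ((hmem w₁).2 ⟨hw₁, hlt⟩) with hw₁ | hw₁
    · exact (List.pairwise_append.1 hl).2.2 w₁ hw₁ w (by simp)
    · have hw₁ := (List.mem_cons.1 hw₁).resolve_left hne
      exact (hno u' (hu' ▸ List.mem_map_of_mem hw₁)).elim
  · exact (hd.2 w x hw).elim

theorem rwReturns_of_respects [IsStrictOrder O lt] (hl : l.Pairwise lt)
    (hmem : ∀ a, a ∈ l ↔ a ∈ A ∧ lt a r) (hr : h.label r = rdLabel x v)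
    (hresp : h.Respects lt A r) : RWReturns (l.map h.label) x v := by
  by_cases hv : v = 0
  · refine .inl ⟨hv, fun u hu => ?_⟩
    obtain ⟨w, hw, hwu⟩ := List.mem_map.1 hu
    obtain ⟨hwA, hwr⟩ := (hmem w).1 hw
    exact irrefl_of lt w (hresp.2 w hwA hwr w ⟨x, v, hr, ⟨u, hwu⟩, .inr ⟨hv, rfl⟩⟩)
  · obtain ⟨w, hwA, hwr, y, u, hw, hy⟩ := hresp.1 ⟨x, v, hr, hv⟩
    obtain ⟨rfl, rfl⟩ := rdLabel_inj.1 (hr.symm.trans hy)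
    obtain ⟨l₁, l₂, rfl⟩ := List.append_of_mem ((hmem w).2 ⟨hwA, hwr⟩)
    refine .inr ⟨l₁.map h.label, l₂.map h.label, by simp [hw], fun u hu => ?_⟩
    obtain ⟨w', hw', hwu⟩ := List.mem_map.1 hu
    have hlt : lt w w' := (List.pairwise_cons.1 (List.pairwise_append.1 hl).2.1).1 w' hw'
    obtain ⟨hwA', hwr'⟩ := (hmem w').1 (by simp [hw'])
    exact asymm_of lt hlt (hresp.2 w' hwA' hwr' w
      ⟨x, v, hr, ⟨u, hwu⟩, .inl ⟨hw, (ne_of_irrefl hlt).symm⟩⟩)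

end Pairwise

theorem replays_iff_respects [IsStrictOrder O lt] (hrw : h.IsRW) (hd : h.Differentiated)
    {l : List O} (hl : l.Pairwise lt) (hA : ∀ a, a ∈ l ↔ a ∈ A) :
    h.Replays K l ↔ ∀ r ∈ A, r ∈ K → h.Respects lt A r := by
  have hmem : ∀ {l₁ r l₂}, l₁ ++ r :: l₂ = l → ∀ a, a ∈ l₁ ↔ a ∈ A ∧ lt a r := by
    rintro l₁ r l₂ rfl a
    rw [mem_left_iff_of_pairwise hl, hA]
  constructor
  · intro hrep r hrA hrK
    obtain ⟨l₁, l₂, e⟩ := List.append_of_mem ((hA r).2 hrA)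
    obtain ⟨x, v, hx | hx⟩ := hrw r
    · exact ⟨fun ⟨y, u, hy, _⟩ => (wrLabel_ne_rdLabel (hx.symm.trans hy)).elim,
        fun w₁ _ _ w₂ ⟨y, u, hy, _⟩ => (wrLabel_ne_rdLabel (hx.symm.trans hy)).elim⟩
    · exact respects_of_rwReturns hd (hl.sublist (e ▸ List.sublist_append_left _ _))
        (hmem e.symm) hx (hrep l₁ r ⟨l₂, by simp [e]⟩ hrK x v hx)
  · rintro hresp l₁ r ⟨l₂, e⟩ hrK x v hx
    have e : l₁ ++ r :: l₂ = l := by simpa using e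
    exact rwReturns_of_respects (hl.sublist (e ▸ List.sublist_append_left _ _)) (hmem e) hx
      (hresp r ((hA r).1 (by simp [← e])) hrK)

theorem isExplained_iff [Finite O] (hrw : h.IsRW) (hd : h.Differentiated) :
    h.IsExplained A K R ↔ ∃ lt : O → O → Prop, IsStrictTotalOrder O lt ∧
      (∀ a ∈ A, ∀ b ∈ A, R a b → lt a b) ∧ ∀ r ∈ A, r ∈ K → h.Respects lt A r := by
  rw [isExplained_iff_exists_replays hrw]
  constructor
  · rintro ⟨l, hnodup, hA, hsub, hl⟩
    obtain ⟨lt, hlt, hpw⟩ := exists_strictTotalOrder_pairwise hnodup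
    exact ⟨lt, hlt, fun a ha b hb hab => by simpa using hpw.sublist (hsub a ha b hb hab),
      (replays_iff_respects hrw hd hpw hA).1 hl⟩
  · rintro ⟨lt, hlt, hR, hresp⟩
    obtain ⟨l, hl, hA⟩ := exists_pairwise_forall_mem_iff A lt
    exact ⟨l, hl.imp fun hab => ne_of_irrefl hab, hA,
      fun a ha b hb hab => sublist_pair_of_pairwise hl ((hA a).2 ha) ((hA b).2 hb)
        (hR a ha b hb hab), (replays_iff_respects hrw hd hl hA).2 hresp⟩

end Respects

/-! ### Causality and happens-before -/

section HappensBefore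

variable {O : Type u} {X : Type v} (h : History O RWMethod (RWData X))

/-- The least transitive relation that contains the program order and reads-from. -/
def History.causal : O → O → Prop :=
  Relation.TransGen fun a b => h.po a b ∨ h.ReadsFrom a b

/-- Every read of a non-initial value has a source. -/
def History.HasSources : Prop := ∀ r, h.NeedsSource r → ∃ w, h.ReadsFrom w r

/-- The order between writes that is forced by the reads in `K` and the order `H`. -/
def History.Forced (K : Set O) (H : O → O → Prop) (a b : O) : Prop :=
  ∃ r ∈ K, h.Conflict a r b ∧ H a r

/-- One round of the saturation of `H` by the order that the reads in `K` force. -/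
def History.saturate (K : Set O) (H : O → O → Prop) : O → O → Prop :=
  Relation.TransGen fun a b => H a b ∨ h.Forced K H a b

/-- The happens-before relation of the reads in `K`: the least transitive relation that contains
the causal order and every order between writes that it forces itself through a read in `K`. -/
inductive History.HappensBefore (K : Set O) : O → O → Prop where
  | causal {a b : O} : h.causal a b → HappensBefore K a b
  | forced {r a b : O} : r ∈ K → h.Conflict a r b → HappensBefore K a r → HappensBefore K a b
  | trans {a b c : O} : HappensBefore K a b → HappensBefore K b c → HappensBefore K a c

variable {h} {K : Set O} {R co : O → O → Prop} {a b o r : O}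

instance History.isTrans_causal : IsTrans O h.causal :=
  inferInstanceAs (IsTrans O (Relation.TransGen _))

theorem History.causal_of_po (hab : h.po a b) : h.causal a b := .single (.inl hab)

theorem History.ReadsFrom.causal (hab : h.ReadsFrom a b) : h.causal a b := .single (.inr hab)

theorem mem_pastOf_self : o ∈ pastOf R o := .inr rfl

theorem mem_pastOf_of_rel [IsTrans O R] (hab : R a b) (hb : b ∈ pastOf R o) : a ∈ pastOf R o := by
  rcases hb with hb | rfl
  · exact .inl (trans_of R hab hb)
  · exact .inl hab

theorem pastOf_mono {S : O → O → Prop} (hRS : ∀ a b, R a b → S a b) : pastOf R o ⊆ pastOf S o :=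
  fun _ ha => ha.imp (hRS _ _) id

theorem History.isChain_pastOf_po (h : History O RWMethod (RWData X)) (o : O) :
    IsChain h.po (pastOf h.po o) := by
  have hsite : ∀ {a}, a ∈ pastOf h.po o → a = o ∨ h.po a o ∨ h.po o a :=
    fun ha => ha.elim (fun ha => .inr (.inl ha)) .inl
  exact fun a ha b hb hab =>
    (h.po_sites.trans (hsite ha) (h.po_sites.symm (hsite hb))).resolve_left hab

section Necessity

variable [Finite O] (hrw : h.IsRW) (hd : h.Differentiated)
include hrw hd

theorem History.IsExplained.exists_source (hE : h.IsExplained (pastOf co r) K R) (hr : r ∈ K)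
    (hn : h.NeedsSource r) : ∃ w, co w r ∧ h.ReadsFrom w r := by
  obtain ⟨lt, hlt, -, hresp⟩ := (isExplained_iff hrw hd).1 hE
  obtain ⟨w, hw, hwr, hrf⟩ := (hresp r mem_pastOf_self hr).1 hn
  rcases hw with hw | rfl
  · exact ⟨w, hw, hrf⟩
  · exact (irrefl_of lt w hwr).elim

theorem hasSources_of_isExplained {K : O → Set O} (hK : ∀ o, o ∈ K o)
    (hE : ∀ o, h.IsExplained (pastOf co o) (K o) R) : h.HasSources :=
  fun r hn => ((hE r).exists_source hrw hd (hK r) hn).imp fun _ hw => hw.2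

theorem causal_le_of_isExplained [IsTrans O co] (hpo : ∀ a b, h.po a b → co a b) {K : O → Set O}
    (hK : ∀ o, o ∈ K o) (hE : ∀ o, h.IsExplained (pastOf co o) (K o) R) :
    ∀ a b, h.causal a b → co a b := by
  refine Relation.transGen_minimal ?_
  rintro a b (hab | hab)
  · exact hpo a b hab
  · obtain ⟨w, hw, hwb⟩ := (hE b).exists_source hrw hd (hK b) (hd.needsSource hab)
    exact hd.source_unique hwb hab ▸ hw

/-- Before an operation of the past `A` of `o`, happens-before stays in `A`, where an explaining
order contains it; from an operation outside of `A`, only the causal order leads anywhere. -/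
theorem happensBefore_irrefl_of_isExplained [IsStrictOrder O co]
    (hco : ∀ a b, h.causal a b → co a b) (hK : K ⊆ pastOf co o)
    (hE : h.IsExplained (pastOf co o) K co) : ¬ h.HappensBefore K a a := by
  obtain ⟨lt, hlt, hle, hresp⟩ := (isExplained_iff hrw hd).1 hE
  have key : ∀ a b, h.HappensBefore K a b →
      (b ∈ pastOf co o → a ∈ pastOf co o ∧ lt a b) ∧ (a ∉ pastOf co o → co a b) := by
    intro a b hab
    induction hab with
    | causal hab =>
      have hab := hco _ _ hab
      refine ⟨fun hb => ?_, fun _ => hab⟩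
      have ha := mem_pastOf_of_rel hab hb
      exact ⟨ha, hle _ ha _ hb hab⟩
    | forced hr hc _ ih =>
      obtain ⟨ha, har⟩ := ih.1 (hK hr)
      exact ⟨fun _ => ⟨ha, (hresp _ (hK hr) hr).2 _ ha har _ hc⟩, fun ha' => (ha' ha).elim⟩
    | trans _ _ ih₁ ih₂ =>
      refine ⟨fun hc => ?_, fun ha => ?_⟩
      · obtain ⟨hb, hbc⟩ := ih₂.1 hc
        obtain ⟨ha, hab⟩ := ih₁.1 hb
        exact ⟨ha, trans_of lt hab hbc⟩
      · exact trans_of co (ih₁.2 ha) (ih₂.2 fun hb => ha (ih₁.1 hb).1)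
  intro haa
  by_cases ha : a ∈ pastOf co o
  · exact irrefl_of lt a ((key a a haa).1 ha).2
  · exact irrefl_of co a ((key a a haa).2 ha)

end Necessity

theorem isExplained_of_happensBefore_irrefl [Finite O] (hrw : h.IsRW) (hd : h.Differentiated)
    (hsrc : h.HasSources) (hK : K ⊆ pastOf h.po o) (hirr : ∀ a, ¬ h.HappensBefore K a a) :
    h.IsExplained (pastOf h.causal o) K h.causal := by
  have : IsStrictOrder O (h.HappensBefore K) := { irrefl := hirr, trans := fun _ _ _ => .trans }
  have hchain : IsChain (h.HappensBefore K) K :=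
    ((h.isChain_pastOf_po o).mono hK).mono_rel fun _ _ hab => .causal (h.causal_of_po hab)
  obtain ⟨lt, hlt, hle, hbefore⟩ := exists_strictTotalOrder_of_isChain _ hchain
  refine (isExplained_iff hrw hd).2 ⟨lt, hlt, fun a _ b _ hab => hle a b (.causal hab),
    fun r hr hrK => ⟨fun hn => ?_, fun w₁ _ hw₁ w₂ hc => ?_⟩⟩
  · obtain ⟨w, hw⟩ := hsrc r hn
    exact ⟨w, mem_pastOf_of_rel hw.causal hr, hle w r (.causal hw.causal), hw⟩
  · exact hle w₁ w₂ (.forced hrK hc (hbefore r hrK w₁ hw₁))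

theorem exists_causalOrder_iff [Finite O] (hrw : h.IsRW) (hd : h.Differentiated) {K : O → Set O}
    (hself : ∀ o, o ∈ K o) (hK : ∀ o, K o ⊆ pastOf h.po o) :
    (∃ co : O → O → Prop, IsStrictOrder O co ∧ (∀ a b, h.po a b → co a b) ∧
      ∀ o, h.IsExplained (pastOf co o) (K o) co) ↔
    h.HasSources ∧ ∀ o a, ¬ h.HappensBefore (K o) a a := by
  constructor
  · rintro ⟨co, hco, hpo, hE⟩
    have hle := causal_le_of_isExplained hrw hd hpo hself hE
    exact ⟨hasSources_of_isExplained hrw hd hself hE, fun o _ =>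
      happensBefore_irrefl_of_isExplained hrw hd hle ((hK o).trans (pastOf_mono hpo)) (hE o)⟩
  · rintro ⟨hsrc, hirr⟩
    exact ⟨h.causal, { irrefl := fun a ha => hirr a a (.causal ha) },
      fun _ _ => h.causal_of_po,
      fun o => isExplained_of_happensBefore_irrefl hrw hd hsrc (hK o) (hirr o)⟩

theorem isCC_iff [Finite O] (hrw : h.IsRW) (hd : h.Differentiated) :
    h.IsCC (rwMemory X) ↔ h.HasSources ∧ ∀ o a, ¬ h.HappensBefore {o} a a :=
  exists_causalOrder_iff hrw hd Set.mem_singleton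
    fun _ => Set.singleton_subset_iff.2 mem_pastOf_self

theorem isCM_iff [Finite O] (hrw : h.IsRW) (hd : h.Differentiated) :
    h.IsCM (rwMemory X) ↔ h.HasSources ∧ ∀ o a, ¬ h.HappensBefore (pastOf h.po o) a a :=
  exists_causalOrder_iff hrw hd (fun _ => mem_pastOf_self) fun _ => subset_rfl

theorem saturate_le_arb [Finite O] (hrw : h.IsRW) (hd : h.Differentiated) {arb : O → O → Prop}
    [IsStrictTotalOrder O arb] (hle : ∀ a b, h.causal a b → co a b)
    (harb : ∀ a b, co a b → arb a b) (hE : ∀ o, h.IsExplained (pastOf co o) {o} arb) :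
    ∀ a b, h.saturate Set.univ h.causal a b → arb a b := by
  refine Relation.transGen_minimal ?_
  rintro w₁ w₂ (hab | ⟨r, -, hc, hw₁⟩)
  · exact harb _ _ (hle _ _ hab)
  obtain ⟨lt, hlt, hR, hresp⟩ := (isExplained_iff hrw hd).1 (hE r)
  have hr : r ∈ pastOf co r := mem_pastOf_self
  have hw₁r := hle _ _ hw₁
  have hlt₁₂ : lt w₁ w₂ := (hresp r hr rfl).2 w₁ (.inl hw₁r)
    (hR w₁ (.inl hw₁r) r hr (harb _ _ hw₁r)) w₂ hc
  rcases hc.eq_or_readsFrom with rfl | hrf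
  · exact (irrefl_of lt w₁ hlt₁₂).elim
  rcases trichotomous_of arb w₁ w₂ with hab | rfl | hba
  · exact hab
  · exact (irrefl_of lt w₁ hlt₁₂).elim
  · exact (asymm_of lt hlt₁₂ (hR w₂ (.inl (hle _ _ hrf.causal)) w₁ (.inl hw₁r) hba)).elim

theorem isExplained_of_saturate_le [Finite O] (hrw : h.IsRW) (hd : h.Differentiated)
    (hsrc : h.HasSources) {arb : O → O → Prop} [IsStrictTotalOrder O arb]
    (harb : ∀ a b, h.saturate Set.univ h.causal a b → arb a b) :
    h.IsExplained (pastOf h.causal o) {o} arb := by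
  refine (isExplained_iff hrw hd).2 ⟨arb, inferInstance, fun _ _ _ _ hab => hab, ?_⟩
  rintro r - rfl
  refine ⟨fun hn => ?_, fun w₁ hw₁ hlt₁ w₂ hc => ?_⟩
  · obtain ⟨w, hw⟩ := hsrc r hn
    exact ⟨w, .inl hw.causal, harb _ _ (.single (.inl hw.causal)), hw⟩
  · rcases hw₁ with hw₁ | rfl
    · exact harb _ _ (.single (.inr ⟨r, trivial, hc, hw₁⟩))
    · exact (irrefl_of arb w₁ hlt₁).elim

theorem isCCv_iff [Finite O] (hrw : h.IsRW) (hd : h.Differentiated) :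
    h.IsCCv (rwMemory X) ↔ h.HasSources ∧ ∀ a, ¬ h.saturate Set.univ h.causal a a := by
  constructor
  · rintro ⟨co, arb, hco, harb, hpo, hle, hE⟩
    have hself : ∀ o : O, o ∈ ({o} : Set O) := Set.mem_singleton
    have hcausal := causal_le_of_isExplained hrw hd hpo hself hE
    exact ⟨hasSources_of_isExplained hrw hd hself hE,
      fun a ha => irrefl_of arb a (saturate_le_arb hrw hd hcausal hle hE a a ha)⟩
  · rintro ⟨hsrc, hirr⟩
    have : IsStrictOrder O (h.saturate Set.univ h.causal) :=
      { irrefl := hirr, trans := fun _ _ _ => .trans }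
    obtain ⟨arb, harb, hle, -⟩ :=
      exists_strictTotalOrder_of_isChain (h.saturate Set.univ h.causal) IsChain.empty
    exact ⟨h.causal, arb, { irrefl := fun a ha => hirr a (.single (.inl ha)) }, harb,
      fun _ _ => h.causal_of_po, fun a b hab => hle a b (.single (.inl hab)),
      fun o => isExplained_of_saturate_le hrw hd hsrc hle⟩

theorem Criterion.holds_of_isEmpty [IsEmpty O] (c : Criterion) : c.Holds h (rwMemory X) := by
  have hempty : ∀ R : O → O → Prop, IsStrictTotalOrder O R := fun R =>
    { irrefl := isEmptyElim, trans := isEmptyElim, trichotomous := isEmptyElim }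
  cases c with
  | CC => exact ⟨h.po, h.po_strict, fun _ _ => id, isEmptyElim⟩
  | CM => exact ⟨h.po, h.po_strict, fun _ _ => id, isEmptyElim⟩
  | CCv => exact ⟨h.po, h.po, h.po_strict, hempty _, fun _ _ => id, fun _ _ => id, isEmptyElim⟩

end HappensBefore

/-! ### Convergence of the saturation -/

section Saturation

variable {O : Type u} {X : Type v} {h : History O RWMethod (RWData X)} {K : Set O}
  {a b c r : O} {m : ℕ}

theorem iterate_saturate_of_causal (hab : h.causal a b) :
    ((h.saturate K)^[m] h.causal) a b := by
  induction m with
  | zero => exact hab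
  | succ m ih =>
    rw [Function.iterate_succ_apply']
    exact .single (.inl ih)

theorem iterate_saturate_trans (hab : ((h.saturate K)^[m] h.causal) a b)
    (hbc : ((h.saturate K)^[m] h.causal) b c) : ((h.saturate K)^[m] h.causal) a c := by
  cases m with
  | zero => exact trans_of h.causal hab hbc
  | succ m =>
    rw [Function.iterate_succ_apply'] at *
    exact hab.trans hbc

theorem iterate_succ_saturate_of_conflict (hr : r ∈ K) (hc : h.Conflict a r b)
    (har : ((h.saturate K)^[m] h.causal) a r) : ((h.saturate K)^[m + 1] h.causal) a b := by
  rw [Function.iterate_succ_apply']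
  exact .single (.inr ⟨r, hr, hc, har⟩)

theorem happensBefore_of_iterate_saturate (hab : ((h.saturate K)^[m] h.causal) a b) :
    h.HappensBefore K a b := by
  induction m generalizing a b with
  | zero => exact .causal hab
  | succ m ih =>
    have : IsTrans O (h.HappensBefore K) := ⟨fun _ _ _ => .trans⟩
    rw [Function.iterate_succ_apply'] at hab
    refine Relation.transGen_minimal (r' := h.HappensBefore K) ?_ _ _ hab
    rintro a b (hab | ⟨r, hr, hc, har⟩)
    · exact ih hab
    · exact .forced hr hc (ih har)

theorem ncard_later_lt [Finite O] {r' : O} (hr' : r' ∈ K) (hrr' : h.po r r') :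
    {s ∈ K | h.po r' s}.ncard < {s ∈ K | h.po r s}.ncard :=
  Set.ncard_lt_ncard ⟨fun _ hs => ⟨hs.1, h.po_strict.trans _ _ _ hrr' hs.2⟩,
    fun hsub => h.po_strict.irrefl r' (hsub ⟨hr', hrr'⟩).2⟩ (Set.toFinite _)

/-- Below a read `r` of the chain `K`, only the forced edges of reads after `r` are ever needed: the
edges forced by `r` itself or by an earlier read start at an operation that is already below `r`. -/
theorem iterate_saturate_of_happensBefore_mem [Finite O] (hK : IsChain h.po K) (hr : r ∈ K)
    (hm : {s ∈ K | h.po r s}.ncard ≤ m) (har : h.HappensBefore K a r) :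
    ((h.saturate K)^[m] h.causal) a r := by
  induction m using Nat.strong_induction_on generalizing r a with
  | _ m ihm =>
  suffices ∀ b, h.HappensBefore K a b → b = r ∨ ((h.saturate K)^[m] h.causal) b r →
      ((h.saturate K)^[m] h.causal) a r from this r har (.inl rfl)
  clear har
  intro b hab hbr
  induction hab with
  | causal hab =>
    rcases hbr with rfl | hbr
    · exact iterate_saturate_of_causal hab
    · exact iterate_saturate_trans (iterate_saturate_of_causal hab) hbr
  | trans _ _ ihab ihbc => exact ihab (.inr (ihbc hbr))
  | @forced r' a b hr' hc har' ih =>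
    rcases eq_or_ne r' r with rfl | hne
    · exact ih (.inl rfl)
    rcases hK hr' hr hne with hlt | hlt
    · exact ih (.inr (iterate_saturate_of_causal (h.causal_of_po hlt)))
    have hcard := ncard_later_lt hr' hlt
    obtain ⟨k, rfl⟩ : ∃ k, m = k + 1 := ⟨m - 1, by omega⟩
    have hab : ((h.saturate K)^[k + 1] h.causal) a b :=
      iterate_succ_saturate_of_conflict hr' hc (ihm k k.lt_succ_self hr' (by omega) har')
    rcases hbr with rfl | hbr
    · exact hab
    · exact iterate_saturate_trans hab hbr

theorem iterate_saturate_card_iff [Finite O] (hK : IsChain h.po K) :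
    ((h.saturate K)^[Nat.card O] h.causal) a b ↔ h.HappensBefore K a b := by
  refine ⟨happensBefore_of_iterate_saturate, fun hab => ?_⟩
  induction hab with
  | causal hab => exact iterate_saturate_of_causal hab
  | trans _ _ ihab ihbc => exact iterate_saturate_trans ihab ihbc
  | @forced r a b hr hc har =>
    have hcard : {s ∈ K | h.po r s}.ncard < Nat.card O :=
      Set.ncard_lt_card fun hall => h.po_strict.irrefl r (Set.eq_univ_iff_forall.1 hall r).2
    obtain ⟨k, hk⟩ : ∃ k, Nat.card O = k + 1 := ⟨Nat.card O - 1, by omega⟩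
    rw [hk]
    exact iterate_succ_saturate_of_conflict hr hc
      (iterate_saturate_of_happensBefore_mem hK hr (by omega) har)

end Saturation

/-! ### Random access programs that restore the registers -/

namespace RamProg

/-- Started with the registers `reg` and the arrays `a`, the program `p` halts after at most `T`
steps, restores the registers and leaves arrays that satisfy `Q`. -/
def Achieves (p : RamProg) (reg : ℕ → ℕ) (a : ℕ → ℕ → ℕ) (T : ℕ) (Q : (ℕ → ℕ → ℕ) → Prop) : Prop :=
  ∃ a' t, Run p ⟨reg, a⟩ ⟨reg, a'⟩ t ∧ t ≤ T ∧ Q a'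

/-- Run `p` for all values of variable `d` below `n`, where register `0` holds `n` and register
`d + 1` holds variable `d`. A variable is `0` when it is not in use. -/
def forLoop (d : ℕ) (p : RamProg) : RamProg :=
  .seq (.loop (.lt (.reg (d + 1)) (.reg 0))
    (.seq p (.assign (d + 1) (.add (.reg (d + 1)) (.const 1))))) (.assign (d + 1) (.const 0))

section Achieves

variable {p q : RamProg} {reg : ℕ → ℕ} {a : ℕ → ℕ → ℕ} {T T' : ℕ} {Q Q' : (ℕ → ℕ → ℕ) → Prop}

theorem Achieves.mono (hp : p.Achieves reg a T Q) (hT : T ≤ T') (hQ : ∀ a', Q a' → Q' a') :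
    p.Achieves reg a T' Q' := by
  obtain ⟨a', t, hrun, ht, ha'⟩ := hp
  exact ⟨a', t, hrun, ht.trans hT, hQ a' ha'⟩

theorem Achieves.seq (hp : p.Achieves reg a T Q) (hq : ∀ a', Q a' → q.Achieves reg a' T' Q') :
    (RamProg.seq p q).Achieves reg a (T + T') Q' := by
  obtain ⟨a₁, t₁, hrun₁, ht₁, ha₁⟩ := hp
  obtain ⟨a₂, t₂, hrun₂, ht₂, ha₂⟩ := hq a₁ ha₁
  exact ⟨a₂, _, .seq _ _ _ _ _ _ _ hrun₁ hrun₂, add_le_add ht₁ ht₂, ha₂⟩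

theorem achieves_store (A : ℕ) (i e : RamExpr)
    (hQ : Q (Function.update a A (Function.update (a A) (i.eval ⟨reg, a⟩) (e.eval ⟨reg, a⟩)))) :
    (store A i e).Achieves reg a (i.cost + e.cost + 1) Q :=
  ⟨_, _, .store A i e _, le_rfl, hQ⟩

variable {n d : ℕ} {I : ℕ → (ℕ → ℕ → ℕ) → Prop}

theorem exists_run_countingLoop (h₀ : reg 0 = n)
    (hbody : ∀ (k : Fin n) (a), I k a →
      p.Achieves (Function.update reg (d + 1) k) a T (I (k + 1))) {m k : ℕ} (hmk : k + m = n)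
    (ha : I k a) :
    ∃ a' t, Run (.loop (.lt (.reg (d + 1)) (.reg 0))
        (.seq p (.assign (d + 1) (.add (.reg (d + 1)) (.const 1)))))
      ⟨Function.update reg (d + 1) k, a⟩ ⟨Function.update reg (d + 1) n, a'⟩ t ∧
        t ≤ m * (T + 8) + 4 ∧ I n a' := by
  induction m generalizing k a with
  | zero =>
    obtain rfl : k = n := hmk
    refine ⟨a, _, .loop_false _ _ _ ?_, by simp [RamExpr.cost], ha⟩
    simp [RamExpr.eval, Function.update, h₀]
  | succ m ih =>
    have hkn : k < n := by omega
    obtain ⟨a₁, t₁, hrun₁, ht₁, ha₁⟩ := hbody ⟨k, hkn⟩ a ha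
    obtain ⟨a₂, t₂, hrun₂, ht₂, ha₂⟩ := ih (k := k + 1) (by omega) ha₁
    refine ⟨a₂, _, .loop_true _ _ _ _ _ _ t₂ ?_ (.seq _ _ _ _ _ _ _ hrun₁ (.assign _ _ _)) ?_,
      ?_, ha₂⟩
    · simp [RamExpr.eval, Function.update, h₀, hkn]
    · simpa [RamExpr.eval] using hrun₂
    · have hsucc : (m + 1) * (T + 8) = m * (T + 8) + (T + 8) := by ring
      simp only [RamExpr.cost]
      omega

theorem achieves_forLoop (h₀ : reg 0 = n) (hd : reg (d + 1) = 0) (ha : I 0 a)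
    (hbody : ∀ (k : Fin n) (a), I k a →
      p.Achieves (Function.update reg (d + 1) k) a T (I (k + 1))) :
    (forLoop d p).Achieves reg a (n * (T + 8) + 6) (I n) := by
  obtain ⟨a', t, hrun, ht, ha'⟩ := exists_run_countingLoop h₀ hbody (zero_add n) ha
  have hreset : Function.update reg (d + 1) 0 = reg := by rw [← hd, Function.update_eq_self]
  rw [hreset] at hrun
  refine ⟨a', _, .seq _ _ _ _ _ t 2 hrun ?_, by omega, ha'⟩
  simpa [RamExpr.eval, RamExpr.cost, hreset]
    using Run.assign (d + 1) (.const 0) ⟨Function.update reg (d + 1) n, a'⟩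

end Achieves

end RamProg

/-! ### Filling a matrix -/

/-- The position of the entry of a matrix, given by two variables. Since programs cannot multiply,
array `4` is to hold the positions of the first entries of the rows. -/
def entryExpr (i j : ℕ) : RamExpr := .add (.get 4 (.reg (i + 1))) (.reg (j + 1))

/-- Fill array `A`, as a matrix, with the values of `e`, in which the variables `d` and `d + 1`
stand for the row and the column. -/
def RamProg.fill (d A : ℕ) (e : RamExpr) : RamProg :=
  .forLoop d (.forLoop (d + 1) (.store A (entryExpr d (d + 1)) e))

/-- The first `m` entries of `b`, read as a matrix row by row, are those of `g`. -/
def AgreesBelow {n : ℕ} (g : Fin n → Fin n → ℕ) (m : ℕ) (b : ℕ → ℕ) : Prop :=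
  ∀ i j : Fin n, (i * n + j : ℕ) < m → b (i * n + j) = g i j

theorem rowMajor_inj {n : ℕ} {i j i' j' : Fin n} :
    (i * n + j : ℕ) = i' * n + j' ↔ i = i' ∧ j = j' := by
  have hval : ∀ a b : Fin n, (finProdFinEquiv (a, b) : ℕ) = a * n + b := fun a b => by
    simp [add_comm, mul_comm]
  rw [← hval, ← hval, Fin.val_inj, finProdFinEquiv.injective.eq_iff, Prod.mk.injEq]

theorem rowMajor_lt {n : ℕ} (i j : Fin n) : (i * n + j : ℕ) < n * n := by
  nlinarith [i.2, j.2]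

section Fill

variable {n d A : ℕ} {reg : ℕ → ℕ} {a : ℕ → ℕ → ℕ} {e : RamExpr} {g : Fin n → Fin n → ℕ}

theorem AgreesBelow.update {b : ℕ → ℕ} {i j : Fin n} (hb : AgreesBelow g (i * n + j) b) :
    AgreesBelow g (i * n + (j + 1)) (Function.update b (i * n + j) (g i j)) := by
  intro i' j' hlt
  by_cases heq : (i' * n + j' : ℕ) = i * n + j
  · obtain ⟨rfl, rfl⟩ := rowMajor_inj.1 heq
    exact Function.update_self ..
  · rw [Function.update_of_ne heq]
    exact hb i' j' (by omega)

theorem achieves_fillRow (hA : A ≠ 4) (hrow : ∀ i : Fin n, a 4 i = i * n) (h₀ : reg 0 = n)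
    (hcol : reg (d + 2) = 0) (i : Fin n)
    (he : ∀ (j : Fin n) b, e.eval ⟨Function.update (Function.update reg (d + 1) i) (d + 2) j,
      Function.update a A b⟩ = g i j) {b : ℕ → ℕ} (hb : AgreesBelow g (i * n) b) :
    (RamProg.forLoop (d + 1) (.store A (entryExpr d (d + 1)) e)).Achieves
      (Function.update reg (d + 1) i) (Function.update a A b) (n * (e.cost + 5 + 8) + 6)
      fun a' => ∃ b, a' = Function.update a A b ∧ AgreesBelow g ((i + 1) * n) b := by
  rw [add_mul, one_mul]
  refine RamProg.achieves_forLoop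
    (I := fun j a' => ∃ b, a' = Function.update a A b ∧ AgreesBelow g (i * n + j) b)
    (by simp [h₀]) (by simp [hcol]) ⟨b, rfl, hb⟩ ?_
  rintro j _ ⟨b, rfl, hb⟩
  refine (RamProg.achieves_store (Q := fun a' => ∃ b, a' = Function.update a A b ∧
    AgreesBelow g (i * n + (j + 1)) b) A _ e ⟨_, ?_, hb.update⟩).mono ?_ fun _ => id
  · have hentry : (entryExpr d (d + 1)).eval ⟨Function.update (Function.update reg (d + 1) i)
        (d + 2) j, Function.update a A b⟩ = i * n + j := by
      simp [entryExpr, RamExpr.eval, hA.symm, hrow]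
    simp [hentry, he]
  · simp only [entryExpr, RamExpr.cost]
    omega

theorem achieves_fill (hA : A ≠ 4) (hrow : ∀ i : Fin n, a 4 i = i * n) (h₀ : reg 0 = n)
    (hd : reg (d + 1) = 0) (hd' : reg (d + 2) = 0)
    (he : ∀ (i j : Fin n) b, e.eval ⟨Function.update (Function.update reg (d + 1) i) (d + 2) j,
      Function.update a A b⟩ = g i j) :
    (RamProg.fill d A e).Achieves reg a (n * (n * (e.cost + 5 + 8) + 6 + 8) + 6)
      fun a' => ∃ b, a' = Function.update a A b ∧ ∀ i j : Fin n, b (i * n + j) = g i j := by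
  refine (RamProg.achieves_forLoop
    (I := fun i a' => ∃ b, a' = Function.update a A b ∧ AgreesBelow g (i * n) b) h₀ hd
    ⟨a A, by simp, fun i j hlt => by simp at hlt⟩ ?_).mono le_rfl ?_
  · rintro i _ ⟨b, rfl, hb⟩
    exact achieves_fillRow hA hrow h₀ hd' i (he i) hb
  · rintro _ ⟨b, rfl, hb⟩
    exact ⟨b, rfl, fun i j => hb i j (rowMajor_lt i j)⟩

end Fill

/-! ### Relational programs -/

/-- The kinds, variables and values of `n` operations, in numbers, and their program order. -/
structure OpTable (n : ℕ) where
  kind : Fin n → ℕ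
  var : Fin n → ℕ
  val : Fin n → ℕ
  po : Fin n → Fin n → Prop

/-- A numbered family of binary relations on `Fin n`, on which relational programs act. -/
abbrev RelStore (n : ℕ) : Type := ℕ → Fin n → Fin n → Prop

/-- Quantifier-free formulas about the operations named by the variables `i` and `j`; `rel m` is the
relation with the number `m` in the store. -/
inductive RelFormula where
  | rel (m i j : ℕ)
  | po (i j : ℕ)
  | isWrite (i : ℕ)
  | sameVar (i j : ℕ)
  | sameVal (i j : ℕ)
  | isZero (i : ℕ)
  | eq (i j : ℕ)
  | not (f : RelFormula)
  | and (f g : RelFormula)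
  | or (f g : RelFormula)

/-- The truth of a formula under the assignment `ρ` of operations to variables. -/
def RelFormula.Holds {n : ℕ} (D : OpTable n) (σ : RelStore n) (ρ : ℕ → Fin n) : RelFormula → Prop
  | .rel m i j => σ m (ρ i) (ρ j)
  | .po i j => D.po (ρ i) (ρ j)
  | .isWrite i => D.kind (ρ i) = 0
  | .sameVar i j => D.var (ρ i) = D.var (ρ j)
  | .sameVal i j => D.val (ρ i) = D.val (ρ j)
  | .isZero i => D.val (ρ i) = 0
  | .eq i j => ρ i = ρ j
  | .not f => ¬ f.Holds D σ ρ
  | .and f g => f.Holds D σ ρ ∧ g.Holds D σ ρ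
  | .or f g => f.Holds D σ ρ ∨ g.Holds D σ ρ

/-- Relational programs. `set m f` redefines the relation `m` by the formula `f`, `each p` runs `p`
once for every operation. Variables are numbered by the nesting depth of their binders; `set` binds
two of them, the row and the column. -/
inductive RelProg where
  | set (m : ℕ) (f : RelFormula)
  | seq (p q : RelProg)
  | each (p : RelProg)

namespace RelProg

variable {n : ℕ}

/-- The effect on the store of a program at nesting depth `d`. -/
def sem (D : OpTable n) : RelProg → ℕ → (ℕ → Fin n) → RelStore n → RelStore n
  | .set m f, d, ρ, σ => Function.update σ m fun i j =>
      f.Holds D σ (Function.update (Function.update ρ d i) (d + 1) j)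
  | .seq p q, d, ρ, σ => q.sem D d ρ (p.sem D d ρ σ)
  | .each p, d, ρ, σ =>
      (List.finRange n).foldl (fun σ k => p.sem D (d + 1) (Function.update ρ d k) σ) σ

/-- The degree of the running time as a polynomial in the number of operations. -/
def degree : RelProg → ℕ
  | .set _ _ => 2
  | .seq p q => max p.degree q.degree
  | .each p => p.degree + 1

end RelProg

theorem foldl_take_finRange_succ {α : Type*} {n : ℕ} (f : α → Fin n → α) (x : α) (k : Fin n) :
    ((List.finRange n).take (k + 1)).foldl f x =
      f (((List.finRange n).take k).foldl f x) k := by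
  rw [List.take_succ_eq_append_getElem (by simp), List.foldl_append]
  simp

theorem foldl_take_finRange_self {α : Type*} {n : ℕ} (f : α → Fin n → α) (x : α) :
    ((List.finRange n).take n).foldl f x = (List.finRange n).foldl f x := by
  rw [List.take_of_length_le (List.length_finRange).le]

theorem foldl_finRange_induction {α : Type*} {n : ℕ} {f : α → Fin n → α} {x : α}
    (P : ℕ → α → Prop) (h₀ : P 0 x) (hsucc : ∀ (k : Fin n) y, P k y → P (k + 1) (f y k)) :
    P n ((List.finRange n).foldl f x) := by
  have key : ∀ k ≤ n, P k (((List.finRange n).take k).foldl f x) := by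
    intro k
    induction k with
    | zero => exact fun _ => h₀
    | succ k ih =>
      intro hk
      rw [foldl_take_finRange_succ f x ⟨k, hk⟩]
      exact hsucc ⟨k, hk⟩ _ (ih (by omega))
  simpa only [foldl_take_finRange_self] using key n le_rfl

/-! ### Compilation of relational programs -/

open Classical in
/-- The number that represents a truth value in memory. -/
noncomputable def truthCode (p : Prop) : ℕ := if p then 1 else 0

section TruthCode

variable {p q : Prop}

theorem ite_eq_truthCode [Decidable p] : (if p then 1 else 0) = truthCode p := by
  unfold truthCode
  congr

theorem truthCode_eq_zero : truthCode p = 0 ↔ ¬ p := by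
  simp [truthCode]

theorem one_lt_truthCode_add : 1 < truthCode p + truthCode q ↔ p ∧ q := by
  by_cases hp : p <;> by_cases hq : q <;> simp [truthCode, hp, hq]

theorem truthCode_add_pos : 0 < truthCode p + truthCode q ↔ p ∨ q := by
  by_cases hp : p <;> by_cases hq : q <;> simp [truthCode, hp, hq]

end TruthCode

/-- The expression that evaluates to the truth value of a formula. -/
def RelFormula.expr : RelFormula → RamExpr
  | .rel m i j => .get (m + 6) (entryExpr i j)
  | .po i j => .get 3 (entryExpr i j)
  | .isWrite i => .eq (.get 0 (.reg (i + 1))) (.const 0)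
  | .sameVar i j => .eq (.get 1 (.reg (i + 1))) (.get 1 (.reg (j + 1)))
  | .sameVal i j => .eq (.get 2 (.reg (i + 1))) (.get 2 (.reg (j + 1)))
  | .isZero i => .eq (.get 2 (.reg (i + 1))) (.const 0)
  | .eq i j => .eq (.reg (i + 1)) (.reg (j + 1))
  | .not f => .eq f.expr (.const 0)
  | .and f g => .lt (.const 1) (.add f.expr g.expr)
  | .or f g => .lt (.const 0) (.add f.expr g.expr)

/-- The random access program that carries out a relational program at nesting depth `d`. A relation
is redefined in array `5` first, since its formula may refer to its old value. -/
def RelProg.compile : RelProg → ℕ → RamProg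
  | .set m f, d =>
      .seq (.fill d 5 f.expr) (.fill d (m + 6) (.get 5 (entryExpr d (d + 1))))
  | .seq p q, d => .seq (p.compile d) (q.compile d)
  | .each p, d => .forLoop d (p.compile (d + 1))

/-- The constant factor in the running time of a compiled program. -/
def RelProg.timeFactor : RelProg → ℕ
  | .set _ f => 2 * (f.expr.cost + 50)
  | .seq p q => p.timeFactor + q.timeFactor
  | .each p => p.timeFactor + 14

/-- The registers hold `n` and the variables `ρ`. -/
structure RegsHold {n : ℕ} (ρ : ℕ → Fin n) (reg : ℕ → ℕ) : Prop where
  size : reg 0 = n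
  var : ∀ v, reg (v + 1) = ρ v

/-- The arrays hold the table `D`, the row positions and the relations `σ`; array `5` is scratch
space. -/
structure ArraysHold {n : ℕ} (D : OpTable n) (σ : RelStore n) (a : ℕ → ℕ → ℕ) : Prop where
  kind : ∀ i : Fin n, a 0 i = D.kind i
  var : ∀ i : Fin n, a 1 i = D.var i
  val : ∀ i : Fin n, a 2 i = D.val i
  po : ∀ i j : Fin n, a 3 (i * n + j) = truthCode (D.po i j)
  row : ∀ i : Fin n, a 4 i = i * n
  rel : ∀ m, ∀ i j : Fin n, a (m + 6) (i * n + j) = truthCode (σ m i j)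

section Compile

variable {n d : ℕ} {D : OpTable n} {σ : RelStore n} {ρ : ℕ → Fin n} {reg : ℕ → ℕ} {a : ℕ → ℕ → ℕ}

theorem RegsHold.update (hreg : RegsHold ρ reg) (d : ℕ) (k : Fin n) :
    RegsHold (Function.update ρ d k) (Function.update reg (d + 1) k) where
  size := by simp [hreg.size]
  var v := by
    by_cases hv : v = d
    · subst hv
      simp
    · simp [hv, hreg.var]

theorem ArraysHold.update_scratch (ha : ArraysHold D σ a) (b : ℕ → ℕ) :
    ArraysHold D σ (Function.update a 5 b) where
  kind := by simpa using ha.kind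
  var := by simpa using ha.var
  val := by simpa using ha.val
  po := by simpa using ha.po
  row := by simpa using ha.row
  rel := by simpa using ha.rel

theorem ArraysHold.update_rel (ha : ArraysHold D σ a) {m : ℕ} {b : ℕ → ℕ}
    {R : Fin n → Fin n → Prop} (hb : ∀ i j : Fin n, b (i * n + j) = truthCode (R i j)) :
    ArraysHold D (Function.update σ m R) (Function.update a (m + 6) b) where
  kind := by simpa using ha.kind
  var := by simpa using ha.var
  val := by simpa using ha.val
  po := by simpa using ha.po
  row := by simpa using ha.row
  rel m' i j := by
    by_cases hm : m' = m
    · subst hm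
      simp [hb]
    · simp [hm, ha.rel]

theorem RelFormula.eval_expr (ha : ArraysHold D σ a) (hreg : RegsHold ρ reg) (f : RelFormula) :
    f.expr.eval ⟨reg, a⟩ = truthCode (f.Holds D σ ρ) := by
  induction f with
  | rel => simp only [expr, entryExpr, RamExpr.eval, hreg.var, ha.row, ha.rel, Holds]
  | po => simp only [expr, entryExpr, RamExpr.eval, hreg.var, ha.row, ha.po, Holds]
  | isWrite => simp only [expr, RamExpr.eval, hreg.var, ha.kind, ite_eq_truthCode, Holds]
  | sameVar => simp only [expr, RamExpr.eval, hreg.var, ha.var, ite_eq_truthCode, Holds]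
  | sameVal => simp only [expr, RamExpr.eval, hreg.var, ha.val, ite_eq_truthCode, Holds]
  | isZero => simp only [expr, RamExpr.eval, hreg.var, ha.val, ite_eq_truthCode, Holds]
  | eq => simp only [expr, RamExpr.eval, hreg.var, Fin.val_inj, ite_eq_truthCode, Holds]
  | not f ih => simp only [expr, RamExpr.eval, ih, truthCode_eq_zero, ↓ite_eq_truthCode, Holds]
  | and f g ihf ihg =>
    simp only [expr, RamExpr.eval, ihf, ihg, one_lt_truthCode_add, ↓ite_eq_truthCode, Holds]
  | or f g ihf ihg =>
    simp only [expr, RamExpr.eval, ihf, ihg, truthCode_add_pos, ↓ite_eq_truthCode, Holds]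

theorem RelProg.achieves_compile_set (m : ℕ) (f : RelFormula) (hρ : ∀ v ≥ d, (ρ v).val = 0)
    (hreg : RegsHold ρ reg) (ha : ArraysHold D σ a) :
    ((set m f).compile d).Achieves reg a ((set m f).timeFactor * n ^ 2)
      (ArraysHold D ((set m f).sem D d ρ σ)) := by
  have hn : 0 < n := (ρ 0).pos
  have hd : reg (d + 1) = 0 := by rw [hreg.var, hρ d le_rfl]
  have hd' : reg (d + 2) = 0 := by rw [hreg.var, hρ (d + 1) (by omega)]
  let R (i j : Fin n) : Prop :=
    f.Holds D σ (Function.update (Function.update ρ d i) (d + 1) j)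
  have hscratch := achieves_fill (g := fun i j => truthCode (R i j)) (A := 5) (by omega) ha.row
    hreg.size hd hd'
    fun i j b => f.eval_expr (ha.update_scratch b) ((hreg.update d i).update (d + 1) j)
  refine (hscratch.seq (T' := n * (n * ((entryExpr 0 0).cost + 1 + 5 + 8) + 6 + 8) + 6) ?_).mono
    ?_ fun _ => id
  · rintro _ ⟨b, rfl, hb⟩
    refine (achieves_fill (g := fun i j => truthCode (R i j)) (A := m + 6) (by omega)
      (ha.update_scratch b).row hreg.size hd hd' fun i j b' => ?_).mono le_rfl ?_
    · simp [entryExpr, RamExpr.eval, ha.row, hb]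
    · rintro _ ⟨b', rfl, hb'⟩
      exact (ha.update_scratch b).update_rel hb'
  · simp only [timeFactor, entryExpr, RamExpr.cost]
    nlinarith [Nat.mul_le_mul hn hn, Nat.mul_le_mul_left n hn]

theorem RelProg.achieves_compile (p : RelProg) (hρ : ∀ v ≥ d, (ρ v).val = 0)
    (hreg : RegsHold ρ reg) (ha : ArraysHold D σ a) :
    (p.compile d).Achieves reg a (p.timeFactor * n ^ p.degree) (ArraysHold D (p.sem D d ρ σ)) := by
  have hn : 0 < n := (ρ 0).pos
  induction p generalizing d σ ρ reg a with
  | set m f => exact achieves_compile_set m f hρ hreg ha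
  | seq p q ihp ihq =>
    refine ((ihp hρ hreg ha).seq fun a' ha' => ihq hρ hreg ha').mono ?_ fun _ => id
    simp only [timeFactor, degree, add_mul]
    gcongr
    exacts [le_max_left .., le_max_right ..]
  | each p ih =>
    let step (σ : RelStore n) (k : Fin n) : RelStore n :=
      p.sem D (d + 1) (Function.update ρ d k) σ
    have hd : reg (d + 1) = 0 := by rw [hreg.var, hρ d le_rfl]
    refine (RamProg.achieves_forLoop (T := p.timeFactor * n ^ p.degree)
      (I := fun k => ArraysHold D (((List.finRange n).take k).foldl step σ)) hreg.size hd ha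
      fun k a ha => ?_).mono ?_ ?_
    · have hρ' : ∀ v ≥ d + 1, (Function.update ρ d k v).val = 0 := fun v hv => by
        rw [Function.update_of_ne (by omega), hρ v (by omega)]
      rw [foldl_take_finRange_succ]
      exact ih hρ' (hreg.update d k) ha
    · have hle : n ≤ n ^ (p.degree + 1) := Nat.le_self_pow (by omega) n
      calc n * (p.timeFactor * n ^ p.degree + 8) + 6
          = p.timeFactor * n ^ (p.degree + 1) + (8 * n + 6) := by ring
        _ ≤ (p.timeFactor + 14) * n ^ (p.degree + 1) := by rw [add_mul]; omega
    · rw [foldl_take_finRange_self]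
      exact fun _ => id

end Compile

/-! ### Building blocks of the decision procedures -/

namespace RelProg

/-- Add to the relation `m` all pairs, named by the variables `d + 1` and `d + 2`, that satisfy `f`
for some value of the variable `d`. -/
def union (m : ℕ) (f : RelFormula) (d : ℕ) : RelProg :=
  .each (.set m (.or (.rel m (d + 1) (d + 2)) f))

/-- Replace the relation `m` by its transitive closure, by Warshall's algorithm. -/
def transClose (m d : ℕ) : RelProg :=
  .each (.set m (.or (.rel m (d + 1) (d + 2)) (.and (.rel m (d + 1) d) (.rel m d (d + 2)))))

section ForAnyTable

variable {n m d : ℕ} {D : OpTable n} {f : RelFormula} {ρ : ℕ → Fin n} {σ : RelStore n}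

theorem sem_set {R : Fin n → Fin n → Prop}
    (hf : ∀ i j, f.Holds D σ (Function.update (Function.update ρ d i) (d + 1) j) ↔ R i j) :
    (set m f).sem D d ρ σ = Function.update σ m R := by
  simp only [sem, hf]

theorem sem_seq {p q : RelProg} : (p.seq q).sem D d ρ σ = q.sem D d ρ (p.sem D d ρ σ) := rfl

theorem sem_union {P : Fin n → Fin n → Fin n → Prop}
    (hf : ∀ R i j k, f.Holds D (Function.update σ m R)
      (Function.update (Function.update (Function.update ρ d k) (d + 1) i) (d + 2) j) ↔ P i j k) :
    (union m f d).sem D d ρ σ = Function.update σ m fun i j => σ m i j ∨ ∃ k, P i j k := by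
  have key := foldl_finRange_induction (x := σ)
    (f := fun σ k => (set m (.or (.rel m (d + 1) (d + 2)) f)).sem D (d + 1)
      (Function.update ρ d k) σ)
    (fun l τ => τ = Function.update σ m fun i j => σ m i j ∨ ∃ k : Fin n, k.val < l ∧ P i j k)
    (by simp) fun k τ hτ => ?_
  · simpa [union, sem] using key
  · subst hτ
    have hsplit : ∀ i j, (∃ l : Fin n, l.val < k + 1 ∧ P i j l) ↔
        (∃ l : Fin n, l.val < k ∧ P i j l) ∨ P i j k := fun i j => by
      simp only [Nat.lt_succ_iff_lt_or_eq, or_and_right, exists_or, Fin.val_inj, exists_eq_left]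
    rw [sem_set (R := fun i j => σ m i j ∨ ∃ l : Fin n, l.val < k + 1 ∧ P i j l),
      Function.update_idem]
    simp only [RelFormula.Holds, Function.update_self, hf, hsplit, ← or_assoc]
    simp [or_assoc]

/-- The effect on a relation of admitting `k` as an intermediate point. -/
def warshallStep (R : Fin n → Fin n → Prop) (k i j : Fin n) : Prop := R i j ∨ R i k ∧ R k j

theorem warshallStep_of_lt {R : Fin n → Fin n → Prop} {k : Fin n}
    (hR : ∀ a b c : Fin n, c.val < k → R a c → R c b → R a b) {a b c : Fin n} (hc : c.val < k + 1)
    (hac : warshallStep R k a c) (hcb : warshallStep R k c b) : warshallStep R k a b := by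
  rcases Nat.lt_succ_iff_lt_or_eq.1 hc with hc | hc
  · rcases hac with hac | ⟨hak, hkc⟩ <;> rcases hcb with hcb | ⟨hck, hkb⟩
    · exact .inl (hR a b c hc hac hcb)
    · exact .inr ⟨hR a k c hc hac hck, hkb⟩
    · exact .inr ⟨hak, hR k b c hc hkc hcb⟩
    · exact .inr ⟨hak, hkb⟩
  · obtain rfl : c = k := Fin.ext hc
    exact .inr ⟨hac.elim id And.left, hcb.elim id And.right⟩

theorem sem_transClose :
    (transClose m d).sem D d ρ σ = Function.update σ m (Relation.TransGen (σ m)) := by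
  have key := foldl_finRange_induction (x := σ)
    (f := fun σ k => (set m (.or (.rel m (d + 1) (d + 2))
      (.and (.rel m (d + 1) d) (.rel m d (d + 2))))).sem D (d + 1) (Function.update ρ d k) σ)
    (fun l τ => ∃ R : Fin n → Fin n → Prop, τ = Function.update σ m R ∧
      (∀ a b, σ m a b → R a b) ∧ (∀ a b, R a b → Relation.TransGen (σ m) a b) ∧
      ∀ a b c : Fin n, c.val < l → R a c → R c b → R a b)
    ⟨σ m, by simp, fun _ _ => id, fun _ _ => .single, fun _ _ _ hlt => by omega⟩ fun k τ hτ => ?_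
  · obtain ⟨R, hR, hle, hge, htrans⟩ := key
    have hclosure : R = Relation.TransGen (σ m) := by
      have : IsTrans (Fin n) R := ⟨fun a c b => htrans a b c c.2⟩
      exact funext₂ fun a b => propext ⟨hge a b, Relation.transGen_minimal hle a b⟩
    simpa [transClose, sem, hclosure] using hR
  · obtain ⟨R, rfl, hle, hge, htrans⟩ := hτ
    refine ⟨warshallStep R k, ?_, fun a b hab => .inl (hle a b hab), ?_,
      fun a b c => warshallStep_of_lt htrans⟩
    · rw [sem_set (R := warshallStep R k), Function.update_idem]
      simp [RelFormula.Holds, warshallStep, Function.update_of_ne (show d ≠ d + 1 + 1 by omega)]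
    · rintro a b (hab | ⟨hak, hkb⟩)
      · exact hge a b hab
      · exact (hge a k hak).trans (hge k b hkb)

end ForAnyTable

end RelProg

/-- The table of the operations of a history. -/
def History.table {X : Type u} {n : ℕ} (h : History (Fin n) RWMethod (RWData X)) (name : X → ℕ) :
    OpTable n where
  kind i := methodCode (h.label i)
  var i := varCode name (h.label i)
  val i := valueCode (h.label i)
  po := h.po

theorem History.table_po {X : Type u} {n : ℕ} (h : History (Fin n) RWMethod (RWData X))
    (name : X → ℕ) : (h.table name).po = h.po := rfl

namespace RelFormula

/-- The formula for `History.ReadsFrom`. -/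
def readsFrom (i j : ℕ) : RelFormula :=
  .and (.isWrite i) (.and (.not (.isWrite j)) (.and (.sameVar i j) (.sameVal i j)))

/-- The formula for `History.NeedsSource`. -/
def needsSource (i : ℕ) : RelFormula := .and (.not (.isWrite i)) (.not (.isZero i))

/-- The formula for `History.Conflict`. -/
def conflict (i k j : ℕ) : RelFormula :=
  .and (.isWrite i) (.and (.not (.isWrite k)) (.and (.sameVar i k)
    (.or (.and (.readsFrom j k) (.not (.eq i j))) (.and (.isZero k) (.eq j i)))))

section Holds

variable {X : Type u} {n : ℕ} {h : History (Fin n) RWMethod (RWData X)} {name : X → ℕ}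
  {σ : RelStore n} {ρ : ℕ → Fin n}

theorem holds_readsFrom (hrw : h.IsRW) (hname : Set.InjOn name h.vars) (i j : ℕ) :
    (readsFrom i j).Holds (h.table name) σ ρ ↔ h.ReadsFrom (ρ i) (ρ j) := by
  obtain ⟨x, v, hi⟩ := hrw (ρ i)
  obtain ⟨y, w, hj⟩ := hrw (ρ j)
  have hxy : name x = name y ↔ x = y := hname.eq_iff ⟨_, v, hi⟩ ⟨_, w, hj⟩
  simp only [readsFrom, Holds, History.table, History.ReadsFrom]
  rcases hi with hi | hi <;> rcases hj with hj | hj <;> rw [hi, hj] <;>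
    simp [wrLabel, rdLabel, methodCode, varCode, valueCode, hxy]

theorem holds_needsSource (hrw : h.IsRW) (i : ℕ) :
    (needsSource i).Holds (h.table name) σ ρ ↔ h.NeedsSource (ρ i) := by
  obtain ⟨x, v, hi⟩ := hrw (ρ i)
  simp only [needsSource, Holds, History.table, History.NeedsSource]
  rcases hi with hi | hi <;> rw [hi] <;> simp [wrLabel, rdLabel, methodCode, valueCode]

theorem holds_conflict (hrw : h.IsRW) (hname : Set.InjOn name h.vars) (i k j : ℕ) :
    (conflict i k j).Holds (h.table name) σ ρ ↔ h.Conflict (ρ i) (ρ k) (ρ j) := by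
  obtain ⟨x, v, hi⟩ := hrw (ρ i)
  obtain ⟨y, w, hk⟩ := hrw (ρ k)
  have hxy : name x = name y ↔ x = y := hname.eq_iff ⟨_, v, hi⟩ ⟨_, w, hk⟩
  simp only [conflict, Holds, holds_readsFrom hrw hname]
  simp only [History.table, History.ReadsFrom, History.Conflict]
  rcases hi with hi | hi <;> rcases hk with hk | hk <;> rw [hi, hk] <;>
    simp [wrLabel, rdLabel, methodCode, varCode, valueCode, hxy]

end Holds

end RelFormula

/-! ### The decision procedures -/

namespace RelProg

/-- Relation `0` becomes the causal order. Relation `2`, the verdict, becomes full if some read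
lacks a source. -/
def prepare : RelProg :=
  .seq (.set 0 (.or (.po 0 1) (.readsFrom 0 1)))
    (.seq (transClose 0 0)
      (.seq (union 1 (.readsFrom 0 1) 0)
        (union 2 (.and (.needsSource 0) (.not (.rel 1 0 0))) 0)))

/-- One round of the saturation of relation `3` by the reads that satisfy `K`, a formula about the
variable `d`. -/
def saturateRound (K : RelFormula) (d : ℕ) : RelProg :=
  .seq (.set 4 (.rel 3 d (d + 1)))
    (.seq (union 4 (.and (.conflict (d + 1) d (d + 2)) (.and (.rel 3 (d + 1) d) K)) d)
      (.seq (transClose 4 d) (.set 3 (.rel 4 d (d + 1)))))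

/-- The verdict becomes full if relation `3` has a cycle. -/
def rejectCycle (d : ℕ) : RelProg := union 2 (.rel 3 d d) d

/-- The verdict becomes full if, for some operation, the happens-before relation of the reads that
satisfy `K` has a cycle. The formula `K` is about the operation, in variable `0`, and the read, in
variable `2`; variable `1` counts the rounds. -/
def rejectHappensBeforeCycle (K : RelFormula) : RelProg :=
  .each (.seq (.set 3 (.rel 0 1 2)) (.seq (.each (saturateRound K 2)) (rejectCycle 1)))

/-- The program that makes the verdict full if the criterion is violated. -/
def refute : Criterion → RelProg
  | .CC => .seq prepare (rejectHappensBeforeCycle (.eq 2 0))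
  | .CM => .seq prepare (rejectHappensBeforeCycle (.or (.po 2 0) (.eq 2 0)))
  | .CCv => .seq prepare
      (.seq (.set 3 (.rel 0 0 1)) (.seq (saturateRound (.eq 0 0) 0) (rejectCycle 0)))

theorem degree_refute_le (c : Criterion) : (refute c).degree ≤ 5 := by
  cases c <;> decide

section Semantics

variable {X : Type u} {n d : ℕ} {h : History (Fin n) RWMethod (RWData X)} {name : X → ℕ}
  {σ : RelStore n} {ρ : ℕ → Fin n} {K : RelFormula}

theorem sem_rejectCycle {D : OpTable n} : (rejectCycle d).sem D d ρ σ =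
    Function.update σ 2 fun i j => σ 2 i j ∨ ∃ a, σ 3 a a := by
  rw [rejectCycle, sem_union (P := fun _ _ a => σ 3 a a)]
  simp [RelFormula.Holds]

theorem sem_prepare (hrw : h.IsRW) (hname : Set.InjOn name h.vars) (hσ : ∀ m a b, ¬ σ m a b) :
    prepare.sem (h.table name) 0 ρ σ 0 = h.causal ∧
      ∀ i j, prepare.sem (h.table name) 0 ρ σ 2 i j ↔ ¬ h.HasSources := by
  have hrf := fun σ ρ => RelFormula.holds_readsFrom (σ := σ) (ρ := ρ) hrw hname
  have hns := fun σ ρ => RelFormula.holds_needsSource (σ := σ) (ρ := ρ) (name := name) hrw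
  simp only [prepare, sem_seq]
  rw [sem_set (R := fun i j => h.po i j ∨ h.ReadsFrom i j), sem_transClose,
    sem_union (m := 1) (P := fun r _ w => h.ReadsFrom w r),
    sem_union (m := 2) (P := fun _ _ r => h.NeedsSource r ∧ ¬ ∃ w, h.ReadsFrom w r)]
  · simp [hσ, History.causal, History.HasSources]
  · simp [RelFormula.Holds, hns, hσ]
  · simp [hrf]
  · simp [RelFormula.Holds, hrf, History.table_po]

theorem sem_saturateRound (hrw : h.IsRW) (hname : Set.InjOn name h.vars) {S : Set (Fin n)}
    (hK : ∀ τ i j k, K.Holds (h.table name) τ (Function.update (Function.update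
      (Function.update ρ d k) (d + 1) i) (d + 2) j) ↔ k ∈ S) :
    (saturateRound K d).sem (h.table name) d ρ σ =
      Function.update (Function.update σ 4 (h.saturate S (σ 3))) 3 (h.saturate S (σ 3)) := by
  have hc := fun σ ρ => RelFormula.holds_conflict (σ := σ) (ρ := ρ) hrw hname
  simp only [saturateRound, sem_seq]
  have hsat : Relation.TransGen (fun i j => σ 3 i j ∨ ∃ k, h.Conflict i k j ∧ σ 3 i k ∧ k ∈ S) =
      h.saturate S (σ 3) := by
    unfold History.saturate History.Forced
    grind
  rw [sem_set (m := 4) (R := σ 3),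
    sem_union (P := fun i j k => h.Conflict i k j ∧ σ 3 i k ∧ k ∈ S), sem_transClose,
    sem_set (m := 3) (R := h.saturate S (σ 3))]
  · simp [hsat]
  · simp [RelFormula.Holds, hsat]
  · simp [RelFormula.Holds, hc, hK]
  · simp [RelFormula.Holds]

theorem sem_each_saturateRound (hrw : h.IsRW) (hname : Set.InjOn name h.vars) {S : Set (Fin n)}
    (hK : ∀ τ i j k l, K.Holds (h.table name) τ (Function.update (Function.update (Function.update
      (Function.update ρ d l) (d + 1) k) (d + 2) i) (d + 3) j) ↔ k ∈ S) :
    ∃ R, (each (saturateRound K (d + 1))).sem (h.table name) d ρ σ =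
      Function.update (Function.update σ 4 R) 3 ((h.saturate S)^[n] (σ 3)) := by
  refine foldl_finRange_induction (x := σ)
    (fun l τ => ∃ R, τ = Function.update (Function.update σ 4 R) 3 ((h.saturate S)^[l] (σ 3)))
    ⟨σ 4, by simp⟩ ?_
  rintro l _ ⟨R, rfl⟩
  refine ⟨h.saturate S ((h.saturate S)^[l] (σ 3)), ?_⟩
  rw [sem_saturateRound hrw hname fun τ i j k => hK τ i j k l, Function.iterate_succ_apply']
  funext m
  by_cases h₃ : m = 3 <;> by_cases h₄ : m = 4 <;> simp [Function.update, h₃, h₄]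

theorem sem_rejectHappensBeforeCycle (hrw : h.IsRW) (hname : Set.InjOn name h.vars)
    (h₀ : σ 0 = h.causal) {S : Fin n → Set (Fin n)} (hS : ∀ o, IsChain h.po (S o))
    (hK : ∀ τ ρ, K.Holds (h.table name) τ ρ ↔ ρ 2 ∈ S (ρ 0)) (i j : Fin n) :
    (rejectHappensBeforeCycle K).sem (h.table name) 0 ρ σ 2 i j ↔
      σ 2 i j ∨ ∃ o a, h.HappensBefore (S o) a a := by
  have key := foldl_finRange_induction (x := σ)
    (f := fun σ o => (seq (.set 3 (.rel 0 1 2)) (.seq (.each (saturateRound K 2))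
      (rejectCycle 1))).sem (h.table name) 1 (Function.update ρ 0 o) σ)
    (fun l τ => τ 0 = h.causal ∧ ∀ i j, τ 2 i j ↔
      σ 2 i j ∨ ∃ o : Fin n, o.val < l ∧ ∃ a, h.HappensBefore (S o) a a)
    ⟨h₀, by simp⟩ fun o τ ⟨hτ₀, hτ₂⟩ => ?_
  · simpa [rejectHappensBeforeCycle, sem] using key.2 i j
  · rw [sem_seq, sem_seq, sem_rejectCycle, sem_set (R := h.causal)]
    · obtain ⟨R, hR⟩ := sem_each_saturateRound (d := 1) (ρ := Function.update ρ 0 o)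
        (σ := Function.update τ 3 h.causal) hrw hname (K := K) (S := S o)
        fun τ i j k l => by simp [hK]
      have hhb : ∀ a b, ((h.saturate (S o))^[n] h.causal) a b ↔ h.HappensBefore (S o) a b := by
        simpa using fun a b => iterate_saturate_card_iff (hS o) (a := a) (b := b)
      have hsplit : (∃ p : Fin n, p.val < o + 1 ∧ ∃ a, h.HappensBefore (S p) a a) ↔
          (∃ p : Fin n, p.val < o ∧ ∃ a, h.HappensBefore (S p) a a) ∨
            ∃ a, h.HappensBefore (S o) a a := by
        simp only [Nat.lt_succ_iff_lt_or_eq, or_and_right, exists_or, Fin.val_inj,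
          exists_eq_left]
      refine ⟨by simp [hR, hτ₀], fun i j => ?_⟩
      rw [hsplit]
      simp [hR, hτ₂, hhb, or_assoc]
    · simp [RelFormula.Holds, hτ₀]

theorem sem_refute (hrw : h.IsRW) (hd : h.Differentiated) (hname : Set.InjOn name h.vars)
    (hσ : ∀ m a b, ¬ σ m a b) (c : Criterion) (i j : Fin n) :
    (refute c).sem (h.table name) 0 ρ σ 2 i j ↔ ¬ c.Holds h (rwMemory X) := by
  obtain ⟨h₀, h₂⟩ := sem_prepare (ρ := ρ) hrw hname hσ
  cases c with
  | CC =>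
    rw [refute, sem_seq, sem_rejectHappensBeforeCycle hrw hname h₀ (S := fun o => {o})
      (fun o => IsChain.singleton) (by simp [RelFormula.Holds]), h₂, Criterion.Holds,
      isCC_iff hrw hd, not_and_or]
    simp
  | CM =>
    rw [refute, sem_seq, sem_rejectHappensBeforeCycle hrw hname h₀ (S := pastOf h.po)
      h.isChain_pastOf_po (by simp [RelFormula.Holds, History.table_po, pastOf]), h₂,
      Criterion.Holds, isCM_iff hrw hd, not_and_or]
    simp
  | CCv =>
    rw [refute, sem_seq, sem_seq, sem_seq, sem_rejectCycle, sem_set (R := h.causal),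
      sem_saturateRound (S := Set.univ) hrw hname (by simp [RelFormula.Holds]), Criterion.Holds,
      isCCv_iff hrw hd, not_and_or]
    · simp [h₂]
    · simp [RelFormula.Holds, h₀]

end Semantics

end RelProg

/-! ### The random access program -/

/-- Fill array `4` with the positions of the first entries of the rows of a matrix. -/
def rowTable : RamProg :=
  .forLoop 0 (.store 4 (.add (.reg 1) (.const 1)) (.add (.get 4 (.reg 1)) (.reg 0)))

theorem achieves_rowTable {n : ℕ} {reg : ℕ → ℕ} {a : ℕ → ℕ → ℕ} (h₀ : reg 0 = n) (h₁ : reg 1 = 0)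
    (ha : a 4 0 = 0) : rowTable.Achieves reg a (16 * n + 6)
      fun a' => ∃ b : ℕ → ℕ, a' = Function.update a 4 b ∧ ∀ i : Fin n, b i = i * n := by
  refine (RamProg.achieves_forLoop (T := 8)
    (I := fun k a' => ∃ b : ℕ → ℕ, a' = Function.update a 4 b ∧ ∀ i ≤ k, b i = i * n) h₀ h₁
    ⟨a 4, by simp, by simp [ha]⟩ ?_).mono (by omega) ?_
  · rintro k _ ⟨b, rfl, hb⟩
    refine RamProg.achieves_store _ _ _ ⟨_, by rw [Function.update_idem], fun i hi => ?_⟩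
    rcases Nat.le_succ_iff.1 hi with hi | rfl
    · simpa [RamExpr.eval, (show i ≠ k + 1 by omega)] using hb i hi
    · simp [RamExpr.eval, hb, h₀, add_mul]
  · rintro _ ⟨b, rfl, hb⟩
    exact ⟨b, rfl, fun i => hb i i.2.le⟩

/-- The random access program that rejects if relation `2`, which lives in array `8`, holds for
operation `0` after `p`. The history without operations is accepted. -/
def decider (p : RelProg) : RamProg :=
  .ite (.eq (.reg 0) (.const 0)) (.assign 0 (.const 1))
    (.seq (.seq rowTable (p.compile 0)) (.assign 0 (.eq (.get 8 (.const 0)) (.const 0))))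

section Decider

variable {X : Type u} {name : X → ℕ} {n : ℕ} {h : History (Fin n) RWMethod (RWData X)}

theorem arraysHold_inputMemory {b : ℕ → ℕ} (hb : ∀ i : Fin n, b i = i * n) :
    ArraysHold (h.table name) (fun _ _ _ => False)
      (Function.update (inputMemory name h).arr 4 b) where
  kind := by simp [inputMemory, History.table]
  var := by simp [inputMemory, History.table]
  val := by simp [inputMemory, History.table]
  po i j := by
    have hentry : (∃ i' j' : Fin n, (i * n + j : ℕ) = i' * n + j' ∧ h.po i' j') ↔ h.po i j := by
      simp [rowMajor_inj, and_assoc]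
    simp [inputMemory, hentry, History.table_po, ite_eq_truthCode]
  row := by simpa using hb
  rel := by simp [inputMemory, truthCode]

theorem exists_run_decider_zero {h : History (Fin 0) RWMethod (RWData X)} (p : RelProg) :
    ∃ s t, RamProg.Run (decider p) (inputMemory name h) s t ∧ t ≤ 6 ∧ s.reg 0 = 1 := by
  refine ⟨_, _, .ite_true _ _ _ _ _ _ ?_ (.assign _ _ _), ?_, ?_⟩
  · simp [RamExpr.eval, inputMemory]
  · simp [RamExpr.cost]
  · simp [RamExpr.eval]

theorem exists_run_decider [NeZero n] (p : RelProg) :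
    ∃ s t, RamProg.Run (decider p) (inputMemory name h) s t ∧
      t ≤ p.timeFactor * n ^ p.degree + 16 * n + 20 ∧
      s.reg 0 = truthCode (¬ p.sem (h.table name) 0 (fun _ => 0) (fun _ _ _ => False) 2 0 0) := by
  obtain ⟨a, t, hrun, ht, ha⟩ : (RamProg.seq rowTable (p.compile 0)).Achieves
      (inputMemory name h).reg (inputMemory name h).arr _ _ :=
    (achieves_rowTable (by simp [inputMemory]) (by simp [inputMemory]) (by simp [inputMemory])).seq
      fun a ⟨b, ha, hb⟩ => p.achieves_compile (ρ := fun _ => 0) (by simp)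
        ⟨by simp [inputMemory], by simp [inputMemory]⟩ (ha ▸ arraysHold_inputMemory hb)
  refine ⟨_, _, .ite_false _ _ _ _ _ _ ?_ (.seq _ _ _ _ _ _ _ hrun (.assign _ _ _)), ?_, ?_⟩
  · simp [RamExpr.eval, inputMemory, NeZero.ne n]
  · simp only [RamExpr.cost]
    omega
  · have hverdict := ha.rel 2 0 0
    simp only [Fin.val_zero, zero_mul, add_zero, Nat.reduceAdd] at hverdict
    simp only [RamExpr.eval, Function.update_self, hverdict, truthCode_eq_zero, ↓ite_eq_truthCode]

theorem exists_run_decider_refute (hrw : h.IsRW) (hd : h.Differentiated)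
    (hname : Set.InjOn name h.vars) (c : Criterion) :
    ∃ s t, RamProg.Run (decider (RelProg.refute c)) (inputMemory name h) s t ∧
      t ≤ (RelProg.refute c).timeFactor * n ^ (RelProg.refute c).degree + 16 * n + 20 ∧
      s.reg 0 = truthCode (c.Holds h (rwMemory X)) := by
  cases n with
  | zero =>
    obtain ⟨s, t, hrun, ht, hs⟩ := exists_run_decider_zero (name := name) (h := h)
      (RelProg.refute c)
    exact ⟨s, t, hrun, by omega, by simp [hs, truthCode, c.holds_of_isEmpty]⟩
  | succ n =>
    obtain ⟨s, t, hrun, ht, hs⟩ := exists_run_decider (name := name) (h := h) (RelProg.refute c)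
    refine ⟨s, t, hrun, ht, ?_⟩
    rw [hs, RelProg.sem_refute hrw hd hname (fun _ _ _ => id), not_not]

end Decider

theorem isBigO_monomial_add_linear {k m : ℕ} (hk : k ≤ m) (hm : m ≠ 0) (A B C : ℕ) :
    Asymptotics.IsBigO Filter.atTop (fun n : ℕ => ((A * n ^ k + B * n + C : ℕ) : ℝ))
      (fun n : ℕ => (n : ℝ) ^ m) := by
  refine Asymptotics.IsBigO.of_bound (A + B + C) ?_
  filter_upwards [Filter.eventually_ge_atTop 1] with n hn
  have hbound : A * n ^ k + B * n + C ≤ (A + B + C) * n ^ m :=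
    calc A * n ^ k + B * n + C ≤ A * n ^ m + B * n ^ m + C * n ^ m := by
          gcongr
          exacts [Nat.le_self_pow hm n, Nat.le_mul_of_pos_right C (pow_pos hn m)]
      _ = (A + B + C) * n ^ m := by ring
  rw [Real.norm_of_nonneg (by positivity), Real.norm_of_nonneg (by positivity)]
  exact_mod_cast hbound

theorem mainTheorem7 (c : Criterion) :
    ∃ (P : RamProg) (T : ℕ → ℕ),
      Asymptotics.IsBigO Filter.atTop (fun n : ℕ => (T n : ℝ)) (fun n : ℕ => (n : ℝ) ^ 5) ∧
      ∀ (X : Type u) (name : X → ℕ) (n : ℕ) (h : History (Fin n) RWMethod (RWData X)),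
        h.IsRW → h.Differentiated → Set.InjOn name h.vars →
        ∃ (s : MemState) (t : ℕ), RamProg.Run P (inputMemory name h) s t ∧ t ≤ T n ∧
          (c.Holds h (rwMemory X) → s.reg 0 = 1) ∧ (¬ c.Holds h (rwMemory X) → s.reg 0 = 0) := by
  refine ⟨decider (RelProg.refute c), _,
    isBigO_monomial_add_linear (RelProg.degree_refute_le c) (by decide)
      (RelProg.refute c).timeFactor 16 20, fun X name n h hrw hd hname => ?_⟩
  obtain ⟨s, t, hrun, ht, hs⟩ := exists_run_decider_refute hrw hd hname c
  exact ⟨s, t, hrun, ht, fun hc => by simp [hs, truthCode, hc],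
    fun hc => by simp [hs, truthCode, hc]⟩
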